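/- **Notation.** For a partition $\lambda\vdash n$ (drawn in English notation, $\lambda$ having rows numbered downwards) let $\dim\lambda$ be the number of standard Young tableaux of shape $\lambda$. The Plancherel measure gives $\lambda\vdash n$ the probability $(\dim\lambda)^2/n!$; write $\mathbb E^{r}_{\mathrm{Pl}}$ for the expectation with respect to it on partitions of $r$. For a standard Young tableau $T$ of shape $\lambda$ let $c_k(T)$ be the content (column minus row) of the box containing $k$, and let $d_k(T)=\varepsilon\,(c_k(T)-c_{k+1}(T))$ for $1\le k\le n-1$, where $\varepsilon\in\{1,-1\}$ is a fixed sign (both conventions are in use; the result holds for each of them). Young's orthogonal representation $\pi^\lambda$ of $S_n$ is given on adjacent transpositions by $$\pi^\lambda((k,k+1))_{T,S}=\begin{cases}1/d_k(T)&\text{if }S=T,\\ \sqrt{1-1/d_k(T)^2}&\text{if }S\text{ is obtained from }T\text{ by exchanging }k\text{ and }k+1,\\ 0&\text{otherwise,}\end{cases}$$ and is extended multiplicatively to $S_n$. The rows and columns of these matrices are arranged in the last letter order: $T$ precedes $S$ if, for the largest entry lying in different rows of $T$ and $S$, its row in $T$ is lower than its row in $S$. Write $\pi^\lambda(\sigma)_{i,j}$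 for the entry at the $i$-th and $j$-th tableaux ($1\le i,j\le\dim\lambda$). For $r\le n$ regard $S_r$ as a subgroup of $S_n$ (the points $r+1,\dots,n$ are fixed). For $\lambda\vdash n$, $\sigma\in S_r$ and real $u,u_1,u_2$ put $$PS^\lambda_{u_1,u_2}(\sigma)=\sum_{i\le u_1\dim\lambda,\;j\le u_2\dim\lambda}\frac{\pi^\lambda(\sigma)_{i,j}}{\dim\lambda},\qquad PS^\lambda_u(\sigma)=PS^\lambda_{u,u}(\sigma),\qquad TS^\lambda(\sigma)=\sum_{i,j\le\dim\lambda}\frac{\pi^\lambda(\sigma)_{i,j}}{\dim\lambda}.$$ **Theorem.** Fix $r\ge 0$ and $\sigma\in S_r$, and let $m_\sigma=\mathbb E^{r}_{\mathrm{Pl}}[TS^\nu(\sigma)]=\sum_{\nu\vdash r}\frac{(\dim\nu)^2}{r!}\,TS^\nu(\sigma)$. For $n\ge r$ let $\lambda\vdash n$ be random with the Plancherel measure. Then, as $n\to\infty$: 1. for every $u\in[0,1]$, $PS^\lambda_u(\sigma)\to u\cdot m_\sigma$ in probability; 2. for all $u_1,u_2\in[0,1]$, $PS^\lambda_{u_1,u_2}(\sigma)\to\min\{u_1,u_2\}\cdot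 m_\sigma$ in probability. -/

import Mathlib

open Filter Topology

/-! ## Partitions of `n`, standard Young tableaux, the last letter order -/

/-- The partitions `lam ⊢ n`, as Young diagrams with `n` cells. A cell is a pair `(row, column)`,
in English notation (rows are numbered downwards), both coordinates starting from `0`. -/
abbrev PartitionOf (n : ℕ) : Type := {lam : YoungDiagram // lam.card = n}

instance finite_partitionOf (n : ℕ) : Finite (PartitionOf n) := by
  have key : ∀ (lam : PartitionOf n) (c : ℕ × ℕ), c ∈ lam.1.cells →
      c ∈ Finset.range n ×ˢ Finset.range n := by
    intro lam c hc
    have hcard : lam.1.cells.card = n := lam.2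
    have h1 : ((Finset.range (c.1 + 1)).image fun i => (i, c.2)) ⊆ lam.1.cells := by
      intro x hx
      obtain ⟨i, hi, rfl⟩ := Finset.mem_image.1 hx
      exact lam.1.up_left_mem (Nat.lt_succ_iff.1 (Finset.mem_range.1 hi)) le_rfl hc
    have h2 : ((Finset.range (c.2 + 1)).image fun j => (c.1, j)) ⊆ lam.1.cells := by
      intro x hx
      obtain ⟨j, hj, rfl⟩ := Finset.mem_image.1 hx
      exact lam.1.up_left_mem le_rfl (Nat.lt_succ_iff.1 (Finset.mem_range.1 hj)) hc
    have h1' := Finset.card_le_card h1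
    have h2' := Finset.card_le_card h2
    rw [Finset.card_image_of_injective _ (fun a b h => (Prod.mk.inj h).1), Finset.card_range,
      hcard] at h1'
    rw [Finset.card_image_of_injective _ (fun a b h => (Prod.mk.inj h).2), Finset.card_range,
      hcard] at h2'
    simp only [Finset.mem_product, Finset.mem_range]
    omega
  refine Finite.of_injective (β := {s : Finset (ℕ × ℕ) //
      s ∈ (Finset.range n ×ˢ Finset.range n).powerset})
    (fun lam => ⟨lam.1.cells, Finset.mem_powerset.2 (key lam)⟩) ?_
  intro a b h
  exact Subtype.ext (YoungDiagram.ext (Subtype.mk.inj h))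

noncomputable instance fintype_partitionOf (n : ℕ) : Fintype (PartitionOf n) :=
  Fintype.ofFinite _

/-- Standard Young tableaux of shape `lam ⊢ n`: bijective fillings of the cells whose entries
increase along rows and along columns. The entries `1, …, n` are written `0, …, n - 1`. -/
abbrev SYT {n : ℕ} (lam : PartitionOf n) : Type :=
  {f : lam.1.cells ≃ Fin n //
    (∀ c d : lam.1.cells, c.1.1 = d.1.1 → c.1.2 < d.1.2 → f c < f d) ∧
    (∀ c d : lam.1.cells, c.1.2 = d.1.2 → c.1.1 < d.1.1 → f c < f d)}

/-- `dim lam`, the number of standard Young tableaux of shape `lam`. -/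
def dimSYT {n : ℕ} (lam : PartitionOf n) : ℕ := Fintype.card (SYT lam)

namespace SYT

variable {n : ℕ} {lam : PartitionOf n}

/-- The row of the box of `T` that contains the entry `k`. -/
def row (T : SYT lam) (k : Fin n) : ℕ := (T.1.symm k).1.1

/-- The column of the box of `T` that contains the entry `k`. -/
def col (T : SYT lam) (k : Fin n) : ℕ := (T.1.symm k).1.2

/-- The content `c_k(T)` (column minus row) of the box of `T` that contains the entry `k`. -/
def content (T : SYT lam) (k : Fin n) : ℤ := (T.col k : ℤ) - (T.row k : ℤ)

/-- The strict last letter order: `T` precedes `S` if, for the largest entry `k` that lies in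
different rows of `T` and `S`, the row of `k` in `T` is lower (has the larger index). -/
def LastLetterLT (T S : SYT lam) : Prop :=
  ∃ k : Fin n, S.row k < T.row k ∧ ∀ l : Fin n, k < l → T.row l = S.row l

instance (T S : SYT lam) : Decidable (LastLetterLT T S) := by
  unfold LastLetterLT; infer_instance

/-- The position `i ∈ {1, …, dim lam}` of `T` in the list of the standard Young tableaux of
shape `lam`, arranged in the last letter order: `T = T_i` for `i = T.index`. -/
def index (T : SYT lam) : ℕ := (Finset.univ.filter fun S : SYT lam => S.LastLetterLT T).card + 1

end SYT

/-! ## Adjacent transpositions -/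

/-- The indices of the adjacent transpositions of `Fin n`. -/
abbrev AdjIndex (n : ℕ) : Type := {k : ℕ // k + 1 < n}

/-- The adjacent transposition that exchanges `k` and `k + 1`. -/
def adjSwap {n : ℕ} (k : AdjIndex n) : Equiv.Perm (Fin n) :=
  Equiv.swap ⟨k.1, Nat.lt_of_succ_lt k.2⟩ ⟨k.1 + 1, k.2⟩

/-- The word `s_m s_{m+1} ⋯ s_{j-1}` in the adjacent transpositions (empty if `j ≤ m`); for
`m ≤ j` its product sends `j` to `m` and fixes all points above `j`. -/
def ascendingWord {n : ℕ} (m j : ℕ) (h : j < n) : List (AdjIndex n) :=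
  List.ofFn fun i : Fin (j - m) => ⟨m + i.1, by omega⟩

/-- A word in the adjacent transpositions whose product is `σ`, if `σ` fixes all points from `j`
on: split off the ascending word that moves `j - 1` to `σ (j - 1)`, and go on with `j - 1`. -/
def adjWordAux {n : ℕ} : (j : ℕ) → j ≤ n → Equiv.Perm (Fin n) → List (AdjIndex n)
  | 0, _, _ => []
  | j + 1, h, σ =>
    ascendingWord (σ ⟨j, h⟩).1 j h ++
      adjWordAux j (Nat.le_of_succ_le h)
        (((ascendingWord (σ ⟨j, h⟩).1 j h).map adjSwap).prod⁻¹ * σ)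

/-- A decomposition of the permutation `σ` into adjacent transpositions. -/
def adjWord {n : ℕ} (σ : Equiv.Perm (Fin n)) : List (AdjIndex n) := adjWordAux n le_rfl σ

theorem ascendingWord_prod {n : ℕ} (j : ℕ) (h : j < n) (d m : ℕ) (hm : m + d = j) :
    ((((ascendingWord m j h).map adjSwap).prod ⟨j, h⟩ : Fin n) : ℕ) = m ∧
    ∀ x : Fin n, j < x.1 → ((ascendingWord m j h).map adjSwap).prod x = x := by
  induction d generalizing m with
  | zero =>
    have hw : ascendingWord m j h = [] :=
      List.length_eq_zero_iff.1 (by simp only [ascendingWord, List.length_ofFn]; omega)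
    rw [hw]
    simp
    omega
  | succ d ih =>
    obtain ⟨h1, h2⟩ := ih (m + 1) (by omega)
    have hw : ascendingWord m j h =
        (⟨m, by omega⟩ : AdjIndex n) :: ascendingWord (m + 1) j h := by
      apply List.ext_getElem
      · simp only [ascendingWord, List.length_ofFn, List.length_cons]; omega
      · intro i hi hi'
        rcases i with _ | i
        · simp [ascendingWord]
        · simp [ascendingWord]; omega
    rw [hw]
    simp only [List.map_cons, List.prod_cons, Equiv.Perm.mul_apply]
    constructor
    · have h3 : ((ascendingWord (m + 1) j h).map adjSwap).prod ⟨j, h⟩ =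
          (⟨m + 1, by omega⟩ : Fin n) := Fin.ext h1
      rw [h3, adjSwap, Equiv.swap_apply_right]
    · intro x hx
      rw [h2 x hx, adjSwap]
      apply Equiv.swap_apply_of_ne_of_ne
      · intro e; rw [e] at hx; simp at hx; omega
      · intro e; rw [e] at hx; simp at hx; omega

theorem adjWordAux_prod {n : ℕ} (j : ℕ) (h : j ≤ n) (σ : Equiv.Perm (Fin n))
    (hσ : ∀ x : Fin n, j ≤ x.1 → σ x = x) :
    ((adjWordAux j h σ).map adjSwap).prod = σ := by
  induction j generalizing σ with
  | zero =>
    have : σ = 1 := Equiv.ext fun x => hσ x (Nat.zero_le _)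
    simp [adjWordAux, this]
  | succ j ih =>
    have hle : (σ ⟨j, h⟩).1 ≤ j := by
      by_contra hlt
      have h1 : σ (σ ⟨j, h⟩) = σ ⟨j, h⟩ := hσ _ (by omega)
      have h2 : (σ ⟨j, h⟩).1 = j := congrArg Fin.val (σ.injective h1)
      omega
    obtain ⟨h1, h2⟩ := ascendingWord_prod j h (j - (σ ⟨j, h⟩).1) (σ ⟨j, h⟩).1 (by omega)
    rw [adjWordAux, List.map_append, List.prod_append, ih, mul_inv_cancel_left]
    intro x hx
    rw [Equiv.Perm.mul_apply, Equiv.Perm.inv_eq_iff_eq]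
    rcases Nat.lt_or_ge j x.1 with hlt | hge
    · rw [hσ x hlt, h2 x hlt]
    · have hxj : x = ⟨j, h⟩ := Fin.ext (by simp; omega)
      rw [hxj]
      exact (Fin.ext h1).symm

/-- The word `adjWord σ` indeed represents `σ`. -/
theorem adjWord_prod {n : ℕ} (σ : Equiv.Perm (Fin n)) :
    ((adjWord σ).map adjSwap).prod = σ :=
  adjWordAux_prod n le_rfl σ fun x hx => absurd x.2 (by omega)

/-! ## Young's orthogonal representation -/

/-- The signed distance `d_k(T) = ε (c_k(T) - c_{k+1}(T))`. Both sign conventions `ε = 1` and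
`ε = -1` are in use. -/
def youngDist (ε : ℤˣ) {n : ℕ} {lam : PartitionOf n} (T : SYT lam) (k : AdjIndex n) : ℤ :=
  (ε : ℤ) * (T.content ⟨k.1, Nat.lt_of_succ_lt k.2⟩ - T.content ⟨k.1 + 1, k.2⟩)

/-- The matrix of the adjacent transposition `(k, k+1)` in Young's orthogonal representation. The
second case says that `S` is obtained from `T` by exchanging the entries `k` and `k + 1` (which is
never standard if these two entries share a row or a column of `T`). -/
noncomputable def youngGenerator (ε : ℤˣ) {n : ℕ} (lam : PartitionOf n) (k : AdjIndex n) :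
    Matrix (SYT lam) (SYT lam) ℝ :=
  Matrix.of fun T S =>
    if T = S then 1 / (youngDist ε T k : ℝ)
    else if S.1 = T.1.trans (adjSwap k) then √(1 - 1 / (youngDist ε T k : ℝ) ^ 2)
    else 0

/-- The matrix `π^lam(σ)` of `σ ∈ S_n` in Young's orthogonal representation: the product of the
matrices of the adjacent transpositions, along a decomposition of `σ` into adjacent transpositions
(since the matrices satisfy the braid relations, the choice of the decomposition is irrelevant). -/
noncomputable def youngOrthogonal (ε : ℤˣ) {n : ℕ} (lam : PartitionOf n)
    (σ : Equiv.Perm (Fin n)) : Matrix (SYT lam) (SYT lam) ℝ :=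
  ((adjWord σ).map (youngGenerator ε lam)).prod

/-- The inclusion `S_r ⊆ S_n`, for `r ≤ n`: the points from `r` on are fixed. -/
def extendPerm {r n : ℕ} (h : r ≤ n) (σ : Equiv.Perm (Fin r)) : Equiv.Perm (Fin n) :=
  σ.viaFintypeEmbedding (Fin.castLEEmb h)

/-! ## Total and partial sums, Plancherel measure -/

/-- The normalized total sum `TS^lam(σ)`. -/
noncomputable def totalSum (ε : ℤˣ) {n : ℕ} (lam : PartitionOf n) (σ : Equiv.Perm (Fin n)) : ℝ :=
  ∑ T : SYT lam, ∑ S : SYT lam, youngOrthogonal ε lam σ T S / (dimSYT lam : ℝ)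

/-- The normalized partial sum `PS^lam_{u₁,u₂}(σ)`: the sum of the `(i, j)` entries with
`i ≤ u₁ dim lam` and `j ≤ u₂ dim lam`, divided by `dim lam`. -/
noncomputable def partialSum₂ (ε : ℤˣ) {n : ℕ} (lam : PartitionOf n) (u₁ u₂ : ℝ)
    (σ : Equiv.Perm (Fin n)) : ℝ :=
  ∑ T : SYT lam with (T.index : ℝ) ≤ u₁ * (dimSYT lam : ℝ),
    ∑ S : SYT lam with (S.index : ℝ) ≤ u₂ * (dimSYT lam : ℝ),
      youngOrthogonal ε lam σ T S / (dimSYT lam : ℝ)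

/-- The normalized partial sum `PS^lam_u(σ)`. -/
noncomputable def partialSum (ε : ℤˣ) {n : ℕ} (lam : PartitionOf n) (u : ℝ)
    (σ : Equiv.Perm (Fin n)) : ℝ :=
  partialSum₂ ε lam u u σ

/-- The expectation of `f` under the Plancherel measure `(dim lam)² / n!` on partitions of `n`. -/
noncomputable def plancherelExp (n : ℕ) (f : PartitionOf n → ℝ) : ℝ :=
  ∑ lam : PartitionOf n, (dimSYT lam : ℝ) ^ 2 / (n.factorial : ℝ) * f lam

/-- The Plancherel probability of a set of partitions of `n`. -/
noncomputable def plancherelProb (n : ℕ) (A : Set (PartitionOf n)) : ℝ :=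
  plancherelExp n (A.indicator 1)

/-- `X_n(lam) → c` in probability as `n → ∞`, where `lam ⊢ n` is Plancherel distributed and
`X_n` is defined for `n ≥ r`. -/
def TendstoInPlancherelProb (r : ℕ) (X : ∀ n : ℕ, r ≤ n → PartitionOf n → ℝ) (c : ℝ) : Prop :=
  ∀ δ : ℝ, 0 < δ →
    Tendsto (fun n : Set.Ici r => plancherelProb n.1 {lam | δ < |X n.1 n.2 lam - c|})
      atTop (𝓝 0)

/-- `m_σ`, the Plancherel average of `TS^ν(σ)` over `ν ⊢ r`, for `σ ∈ S_r`. -/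
noncomputable def meanTotalSum (ε : ℤˣ) {r : ℕ} (σ : Equiv.Perm (Fin r)) : ℝ :=
  plancherelExp r fun ν => totalSum ε ν σ

/-!
The proof rests on two facts: the position of the largest entry separates the tableaux of a large
shape into blocks of consecutive tableaux, each of them small compared with the whole, and on most of
these blocks the normalized total sum is close to the same number `m_σ`.

*Branching.* Deleting the largest entry identifies the tableaux of shape `lam ⊢ n + 1` with those of
the shapes `mu` below `lam` (`SYT.branchEquiv`). The chosen word for `σ` does not change when `σ` is
regarded as a permutation of more points (`adjWord_succ`), so that the matrices of `lam` are block
diagonal with the matrices of the shapes `mu` as blocks (`youngOrthogonal_extendPerm`); neither the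
braid relations nor orthogonality are needed. In particular the unnormalized total sum
`H (lam) = dim lam * TS^lam(σ)` satisfies `H = U H`, where `U` is the up operator of Young's
lattice, and so does the dimension function itself.

*Concentration of the total sum.* Under the Plancherel measure, the second moment of
`TS^lam(σ) - m_σ` is the squared norm of `h = H - m_σ dim`, divided by `n!`. The choice of `m_σ`
makes `h` orthogonal to the dimension function on the partitions of `r`. From the commutation
relation `D U = 1 + U D` (`PartitionOf.down_up`) an induction on `r` gives that an orbit of `U` with
this property has squared norm `O(n! / n)` (`PartitionOf.exists_orbit_bound`).

*Partial sums.* In the last letter order the blocks of the shapes `mu` are intervals, arranged by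
the row of the removed cell. A cutoff at `u₁ dim lam` and `u₂ dim lam` keeps the blocks up to
`min u₁ u₂ * dim lam`, drops the later ones, and cuts at most one block
(`abs_partialSum_sub_le`). The kept blocks contribute the average of `|TS^mu(σ) - m_σ|` as error;
since the weights `(dim lam)(dim mu) / n!` on the pairs `mu ≤ lam` have Plancherel marginals, its
expectation is that of the previous step, one size smaller. The cut block contributes
`O(dim mu / dim lam)`, as the row sums of absolute values of `π^mu(σ)` are bounded by a constant that
depends only on `σ`. Finally `max dim mu / dim lam` is small on average: its second moment is at most
the sum of `(dim mu)² / (n + 1)!` over all pairs `mu ≤ lam` with `mu ⊢ n`, and a partition of `n` has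
only `O(√n)` upper covers (`sum_up_dimFun_sq_le`).
-/

/-! ### Covering relations between Young diagrams -/

instance YoungDiagram.decidableLE : DecidableLE YoungDiagram := fun mu lam =>
  decidable_of_iff (mu.cells ⊆ lam.cells) YoungDiagram.cells_subset_iff

instance YoungDiagram.instDecidableEq : DecidableEq YoungDiagram := fun mu lam =>
  decidable_of_iff (mu.cells = lam.cells) YoungDiagram.ext_iff.symm

theorem YoungDiagram.eq_of_le_of_card_le {mu lam : YoungDiagram} (h : mu ≤ lam)
    (hc : lam.card ≤ mu.card) : mu = lam :=
  YoungDiagram.ext (Finset.eq_of_subset_of_card_le (YoungDiagram.cells_subset_iff.2 h) hc)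

namespace PartitionOf

variable {n : ℕ}

/-- The partitions of `n` obtained from `lam ⊢ n + 1` by removing a cell. -/
noncomputable def below (lam : PartitionOf (n + 1)) : Finset (PartitionOf n) :=
  Finset.univ.filter fun mu => mu.1 ≤ lam.1

/-- The partitions of `n + 1` obtained from `mu ⊢ n` by adding a cell. -/
noncomputable def above (mu : PartitionOf n) : Finset (PartitionOf (n + 1)) :=
  Finset.univ.filter fun lam => mu.1 ≤ lam.1

@[simp]
theorem mem_below {lam : PartitionOf (n + 1)} {mu : PartitionOf n} :
    mu ∈ below lam ↔ mu.1 ≤ lam.1 := by simp [below]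

@[simp]
theorem mem_above {lam : PartitionOf (n + 1)} {mu : PartitionOf n} :
    lam ∈ above mu ↔ mu.1 ≤ lam.1 := by simp [above]

/-- A cover in Young's lattice adds exactly one cell. -/
theorem exists_new_cell {mu : PartitionOf n} {lam : PartitionOf (n + 1)} (h : mu.1 ≤ lam.1) :
    ∃ c, c ∉ mu.1 ∧ ∀ d, d ∈ lam.1 ↔ d = c ∨ d ∈ mu.1 := by
  have h1 : mu.1.cells.card + 1 = lam.1.cells.card := by
    have h2 : mu.1.cells.card = n := mu.2
    have h3 : lam.1.cells.card = n + 1 := lam.2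
    omega
  obtain ⟨c, hc, hi⟩ := Finset.exists_eq_insert_iff.2 ⟨YoungDiagram.cells_subset_iff.2 h, h1⟩
  refine ⟨c, by simpa using hc, fun d => ?_⟩
  rw [← YoungDiagram.mem_cells, ← hi, Finset.mem_insert, YoungDiagram.mem_cells]

theorem eq_sup_of_le {lam lam' : PartitionOf (n + 1)} (hne : lam ≠ lam')
    {kap : PartitionOf (n + 2)} (h : lam.1 ≤ kap.1) (h' : lam'.1 ≤ kap.1) :
    kap.1 = lam.1 ⊔ lam'.1 := by
  symm
  apply YoungDiagram.eq_of_le_of_card_le (sup_le h h')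
  rw [kap.2]
  by_contra hlt
  have h1 : (lam.1 ⊔ lam'.1).card ≤ n + 1 := by omega
  apply hne
  apply Subtype.ext
  rw [YoungDiagram.eq_of_le_of_card_le (le_sup_left : lam.1 ≤ lam.1 ⊔ lam'.1)
    (by rw [lam.2]; exact h1)]
  rw [← YoungDiagram.eq_of_le_of_card_le (le_sup_right : lam'.1 ≤ lam.1 ⊔ lam'.1)
    (by rw [lam'.2]; exact h1)]

theorem eq_inf_of_le {lam lam' : PartitionOf (n + 1)} (hne : lam ≠ lam')
    {mu : PartitionOf n} (h : mu.1 ≤ lam.1) (h' : mu.1 ≤ lam'.1) :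
    mu.1 = lam.1 ⊓ lam'.1 := by
  apply YoungDiagram.eq_of_le_of_card_le (le_inf h h')
  rw [mu.2]
  by_contra hlt
  have h1 : n + 1 ≤ (lam.1 ⊓ lam'.1).card := by omega
  apply hne
  apply Subtype.ext
  rw [← YoungDiagram.eq_of_le_of_card_le (inf_le_left : lam.1 ⊓ lam'.1 ≤ lam.1)
    (by rw [lam.2]; exact h1)]
  exact YoungDiagram.eq_of_le_of_card_le (inf_le_right : lam.1 ⊓ lam'.1 ≤ lam'.1)
    (by rw [lam'.2]; exact h1)

/-- Two distinct diagrams of the same size have as many common upper covers as common lower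
covers: the only candidates are the union and the intersection, whose sizes add up to the total
size of the two diagrams. -/
theorem card_above_inter_above {lam lam' : PartitionOf (n + 1)} (hne : lam ≠ lam') :
    (above lam ∩ above lam').card = (below lam ∩ below lam').card := by
  have hsum : (lam.1 ⊔ lam'.1).card + (lam.1 ⊓ lam'.1).card = (n + 1) + (n + 1) := by
    have := Finset.card_union_add_card_inter lam.1.cells lam'.1.cells
    have h2 : lam.1.cells.card = n + 1 := lam.2
    have h3 : lam'.1.cells.card = n + 1 := lam'.2
    rw [h2, h3] at this
    exact this
  by_cases hc : (lam.1 ⊔ lam'.1).card = n + 2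
  · have hc' : (lam.1 ⊓ lam'.1).card = n := by omega
    have h1 : above lam ∩ above lam' = {⟨lam.1 ⊔ lam'.1, hc⟩} := by
      ext kap
      simp only [Finset.mem_inter, mem_above, Finset.mem_singleton]
      constructor
      · rintro ⟨h, h'⟩
        exact Subtype.ext (eq_sup_of_le hne h h')
      · rintro rfl
        exact ⟨le_sup_left, le_sup_right⟩
    have h2 : below lam ∩ below lam' = {⟨lam.1 ⊓ lam'.1, hc'⟩} := by
      ext kap
      simp only [Finset.mem_inter, mem_below, Finset.mem_singleton]
      constructor
      · rintro ⟨h, h'⟩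
        exact Subtype.ext (eq_inf_of_le hne h h')
      · rintro rfl
        exact ⟨inf_le_left, inf_le_right⟩
    rw [h1, h2, Finset.card_singleton, Finset.card_singleton]
  · have h1 : above lam ∩ above lam' = ∅ := by
      rw [Finset.eq_empty_iff_forall_notMem]
      intro kap hk
      simp only [Finset.mem_inter, mem_above] at hk
      exact hc (by rw [← eq_sup_of_le hne hk.1 hk.2, kap.2])
    have h2 : below lam ∩ below lam' = ∅ := by
      rw [Finset.eq_empty_iff_forall_notMem]
      intro mu hk
      simp only [Finset.mem_inter, mem_below] at hk
      have : (lam.1 ⊓ lam'.1).card = n := by rw [← eq_inf_of_le hne hk.1 hk.2, mu.2]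
      omega
    rw [h1, h2, Finset.card_empty, Finset.card_empty]

/-! ### Corners -/

/-- The rows of `lam` whose last cell can be removed. -/
def removableRows (lam : PartitionOf n) : Finset ℕ :=
  (Finset.range n).filter fun i => lam.1.rowLen (i + 1) < lam.1.rowLen i

/-- The rows of `lam`, possibly empty, to which a cell can be added. -/
def addableRows (lam : PartitionOf n) : Finset ℕ :=
  insert 0 ((removableRows lam).image Nat.succ)

theorem card_addableRows (lam : PartitionOf n) :
    (addableRows lam).card = (removableRows lam).card + 1 := by
  rw [addableRows, Finset.card_insert_of_notMem (by simp),
    Finset.card_image_of_injective _ Nat.succ_injective]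

theorem lt_of_mem {lam : PartitionOf n} {i j : ℕ} (h : (i, j) ∈ lam.1) : i < n := by
  have h1 : ((Finset.range (i + 1)).image fun i => (i, j)) ⊆ lam.1.cells := by
    intro x hx
    obtain ⟨i', hi, rfl⟩ := Finset.mem_image.1 hx
    exact lam.1.up_left_mem (Nat.lt_succ_iff.1 (Finset.mem_range.1 hi)) le_rfl h
  have h2 := Finset.card_le_card h1
  have h3 : lam.1.cells.card = n := lam.2
  rw [Finset.card_image_of_injective _ (fun a b h => (Prod.mk.inj h).1), Finset.card_range,
    h3] at h2
  omega

theorem mem_removableRows {lam : PartitionOf n} {i : ℕ} :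
    i ∈ removableRows lam ↔ lam.1.rowLen (i + 1) < lam.1.rowLen i := by
  simp only [removableRows, Finset.mem_filter, Finset.mem_range, and_iff_right_iff_imp]
  intro h
  exact lt_of_mem (YoungDiagram.mem_iff_lt_rowLen.2 h)

theorem mem_addableRows {lam : PartitionOf n} {i : ℕ} :
    i ∈ addableRows lam ↔ ∀ i' < i, lam.1.rowLen i < lam.1.rowLen i' := by
  simp only [addableRows, Finset.mem_insert, Finset.mem_image, mem_removableRows]
  constructor
  · rintro (rfl | ⟨j, hj, rfl⟩) i' hi
    · omega
    · exact hj.trans_le (lam.1.rowLen_anti _ _ (by omega))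
  · intro h
    rcases i with _ | i
    · exact Or.inl rfl
    · exact Or.inr ⟨i, h i (Nat.lt_succ_self i), rfl⟩

/-- Adding a cell at the end of an addable row. -/
def addCell (lam : PartitionOf n) (i : ℕ) (hi : i ∈ addableRows lam) : PartitionOf (n + 1) :=
  ⟨{ cells := insert (i, lam.1.rowLen i) lam.1.cells
     isLowerSet := by
      rintro ⟨a, b⟩ ⟨a', b'⟩ hle h
      obtain ⟨hle1, hle2⟩ := Prod.mk_le_mk.1 hle
      simp only [Finset.coe_insert, Set.mem_insert_iff, Finset.mem_coe, YoungDiagram.mem_cells,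
        Prod.mk.injEq] at h ⊢
      rcases h with ⟨rfl, rfl⟩ | h
      · rcases hle1.eq_or_lt with rfl | hlt
        · rcases hle2.eq_or_lt with rfl | hlt2
          · exact Or.inl ⟨rfl, rfl⟩
          · exact Or.inr (YoungDiagram.mem_iff_lt_rowLen.2 hlt2)
        · exact Or.inr (YoungDiagram.mem_iff_lt_rowLen.2
            (hle2.trans_lt (mem_addableRows.1 hi _ hlt)))
      · exact Or.inr (lam.1.up_left_mem hle1 hle2 h) }, by
    have h : (i, lam.1.rowLen i) ∉ lam.1.cells := by
      rw [YoungDiagram.mem_cells, YoungDiagram.mem_iff_lt_rowLen]; omega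
    have h3 : lam.1.cells.card = n := lam.2
    change (insert (i, lam.1.rowLen i) lam.1.cells).card = n + 1
    rw [Finset.card_insert_of_notMem h, h3]⟩

theorem mem_addCell {lam : PartitionOf n} {i : ℕ} {hi : i ∈ addableRows lam} {c : ℕ × ℕ} :
    c ∈ (addCell lam i hi).1 ↔ c = (i, lam.1.rowLen i) ∨ c ∈ lam.1 := by
  simp [addCell, ← YoungDiagram.mem_cells]

theorem card_above (lam : PartitionOf n) : (above lam).card = (removableRows lam).card + 1 := by
  rw [← card_addableRows]
  symm
  refine Finset.card_bij (addCell lam) ?_ ?_ ?_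
  · intro i hi
    rw [mem_above]
    intro c hc
    exact mem_addCell.2 (Or.inr hc)
  · intro i hi i' hi' h
    have h1 : (i, lam.1.rowLen i) ∈ (addCell lam i hi).1 := mem_addCell.2 (Or.inl rfl)
    rw [h, mem_addCell] at h1
    rcases h1 with h1 | h1
    · exact (Prod.mk.inj h1).1
    · rw [YoungDiagram.mem_iff_lt_rowLen] at h1; omega
  · intro kap hk
    obtain ⟨⟨i, j⟩, hc, hd⟩ := exists_new_cell (mem_above.1 hk)
    have hcmem : (i, j) ∈ kap.1 := (hd _).2 (Or.inl rfl)
    have hj : j = lam.1.rowLen i := by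
      rw [YoungDiagram.mem_iff_lt_rowLen] at hc
      rcases (not_lt.1 hc).eq_or_lt with h | h
      · exact h.symm
      · have h1 := (hd _).1 (kap.1.up_left_mem le_rfl h.le hcmem)
        rw [YoungDiagram.mem_iff_lt_rowLen, Prod.mk.injEq] at h1
        omega
    have hi : i ∈ addableRows lam := by
      rw [mem_addableRows]
      intro i' hi'
      have h1 := (hd _).1 (kap.1.up_left_mem hi'.le le_rfl hcmem)
      rw [YoungDiagram.mem_iff_lt_rowLen, Prod.mk.injEq] at h1
      omega
    refine ⟨i, hi, Subtype.ext (SetLike.ext fun c => ?_)⟩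
    rw [mem_addCell, hd, hj]

/-- Removing the last cell of a removable row. -/
def removeCell (lam : PartitionOf (n + 1)) (i : ℕ) (hi : i ∈ removableRows lam) :
    PartitionOf n :=
  ⟨{ cells := lam.1.cells.erase (i, lam.1.rowLen i - 1)
     isLowerSet := by
      rw [mem_removableRows] at hi
      rintro ⟨a, b⟩ ⟨a', b'⟩ hle h
      obtain ⟨hle1, hle2⟩ := Prod.mk_le_mk.1 hle
      simp only [Finset.coe_erase, Set.mem_sdiff, Finset.mem_coe, YoungDiagram.mem_cells,
        Set.mem_singleton_iff, Prod.mk.injEq] at h ⊢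
      refine ⟨lam.1.up_left_mem hle1 hle2 h.1, ?_⟩
      rintro ⟨rfl, rfl⟩
      have h1 := YoungDiagram.mem_iff_lt_rowLen.1 h.1
      rcases hle1.eq_or_lt with rfl | hlt
      · exact h.2 ⟨rfl, by omega⟩
      · have h2 := lam.1.rowLen_anti _ _ (Nat.succ_le_of_lt hlt)
        simp only [Nat.succ_eq_add_one] at h2
        omega }, by
    rw [mem_removableRows] at hi
    have h : (i, lam.1.rowLen i - 1) ∈ lam.1.cells := by
      rw [YoungDiagram.mem_cells, YoungDiagram.mem_iff_lt_rowLen]; omega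
    have h3 : lam.1.cells.card = n + 1 := lam.2
    change (lam.1.cells.erase (i, lam.1.rowLen i - 1)).card = n
    rw [Finset.card_erase_of_mem h, h3, Nat.add_sub_cancel]⟩

theorem mem_removeCell {lam : PartitionOf (n + 1)} {i : ℕ} {hi : i ∈ removableRows lam}
    {c : ℕ × ℕ} :
    c ∈ (removeCell lam i hi).1 ↔ c ≠ (i, lam.1.rowLen i - 1) ∧ c ∈ lam.1 := by
  simp [removeCell, ← YoungDiagram.mem_cells]

theorem card_below (lam : PartitionOf (n + 1)) :
    (below lam).card = (removableRows lam).card := by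
  symm
  refine Finset.card_bij (removeCell lam) ?_ ?_ ?_
  · intro i hi
    rw [mem_below]
    intro c hc
    exact (mem_removeCell.1 hc).2
  · intro i hi i' hi' h
    by_contra hne
    have h1 : (i, lam.1.rowLen i - 1) ∈ (removeCell lam i' hi').1 := by
      rw [mem_removeCell, YoungDiagram.mem_iff_lt_rowLen, Ne, Prod.mk.injEq]
      rw [mem_removableRows] at hi
      exact ⟨fun h => hne h.1, by omega⟩
    rw [← h, mem_removeCell] at h1
    exact h1.1 rfl
  · intro mu hk
    obtain ⟨⟨i, j⟩, hc, hd⟩ := exists_new_cell (mem_below.1 hk)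
    have hcmem : (i, j) ∈ lam.1 := (hd _).2 (Or.inl rfl)
    have hj : lam.1.rowLen i = j + 1 := by
      have h0 := YoungDiagram.mem_iff_lt_rowLen.1 hcmem
      by_contra hne
      have h1 : (i, j + 1) ∈ lam.1 := YoungDiagram.mem_iff_lt_rowLen.2 (by omega)
      rcases (hd _).1 h1 with h2 | h2
      · simp at h2
      · exact hc (mu.1.up_left_mem le_rfl (Nat.le_succ j) h2)
    have hi : i ∈ removableRows lam := by
      rw [mem_removableRows]
      by_contra hne
      have h1 : (i + 1, j) ∈ lam.1 := YoungDiagram.mem_iff_lt_rowLen.2 (by omega)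
      rcases (hd _).1 h1 with h2 | h2
      · simp at h2
      · exact hc (mu.1.up_left_mem (Nat.le_succ i) le_rfl h2)
    refine ⟨i, hi, Subtype.ext (SetLike.ext fun c => ?_)⟩
    rw [mem_removeCell, hd, hj, Nat.add_sub_cancel]
    constructor
    · rintro ⟨h1, h2 | h2⟩
      · exact absurd h2 h1
      · exact h2
    · intro h
      exact ⟨fun h1 => hc (h1 ▸ h), Or.inr h⟩

/-- A partition of `n` has at most `√(2n)` corners: for two corners, the cell in the upper of their
two rows and the left of their two columns belongs to the diagram, and determines the pair. -/
theorem card_removableRows_sq_le (lam : PartitionOf n) :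
    (removableRows lam).card ^ 2 ≤ 2 * n := by
  set R := removableRows lam with hR
  set P := (R ×ˢ R).filter fun p => p.1 ≤ p.2 with hP
  have hP1 : P.card ≤ n := by
    have h3 : lam.1.cells.card = n := lam.2
    rw [← h3]
    refine Finset.card_le_card_of_injOn (fun p => (p.1, lam.1.rowLen p.2 - 1)) ?_ ?_
    · rintro ⟨a, b⟩ hp
      simp only [hP, Finset.coe_filter, Finset.mem_product, Set.mem_ofPred_eq, hR,
        mem_removableRows] at hp
      have := lam.1.rowLen_anti _ _ hp.2
      simp only [Finset.mem_coe, YoungDiagram.mem_cells, YoungDiagram.mem_iff_lt_rowLen]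
      omega
    · rintro ⟨a, b⟩ hp ⟨a', b'⟩ hp' h
      simp only [hP, Finset.coe_filter, Finset.mem_product, Set.mem_ofPred_eq, hR,
        mem_removableRows] at hp hp'
      simp only [Prod.mk.injEq] at h
      refine Prod.ext h.1 ?_
      rcases lt_trichotomy b b' with hlt | heq | hlt
      · have := lam.1.rowLen_anti _ _ (Nat.succ_le_of_lt hlt)
        simp only [Nat.succ_eq_add_one] at this
        omega
      · exact heq
      · have := lam.1.rowLen_anti _ _ (Nat.succ_le_of_lt hlt)
        simp only [Nat.succ_eq_add_one] at this
        omega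
  have hP2 : R ×ˢ R ⊆ P ∪ P.image Prod.swap := by
    rintro ⟨a, b⟩ hp
    rw [Finset.mem_union, Finset.mem_image]
    rcases le_total a b with h | h
    · exact Or.inl (Finset.mem_filter.2 ⟨hp, h⟩)
    · refine Or.inr ⟨(b, a), Finset.mem_filter.2 ⟨?_, h⟩, rfl⟩
      rw [Finset.mem_product] at hp ⊢
      exact hp.symm
  have h1 := (Finset.card_le_card hP2).trans (Finset.card_union_le _ _)
  have h2 : (P.image Prod.swap).card ≤ P.card := Finset.card_image_le
  rw [Finset.card_product] at h1
  rw [sq]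
  omega

theorem card_above_eq_card_below_add_one (lam : PartitionOf (n + 1)) :
    (above lam).card = (below lam).card + 1 := by
  rw [card_above, card_below]

end PartitionOf

/-! ### The up and down operators -/

namespace PartitionOf

variable {n : ℕ}

/-- The up operator of Young's lattice. -/
noncomputable def up (h : PartitionOf n → ℝ) (lam : PartitionOf (n + 1)) : ℝ :=
  ∑ mu ∈ below lam, h mu

/-- The down operator of Young's lattice, the adjoint of the up operator. -/
noncomputable def down (h : PartitionOf (n + 1) → ℝ) (mu : PartitionOf n) : ℝ :=
  ∑ lam ∈ above mu, h lam

theorem up_sub (g h : PartitionOf n → ℝ) : up (g - h) = up g - up h := by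
  ext lam; simp [up, Finset.sum_sub_distrib]

theorem up_smul (a : ℝ) (h : PartitionOf n → ℝ) : up (a • h) = a • up h := by
  ext lam; simp [up, Finset.mul_sum]

theorem up_zero : up (0 : PartitionOf n → ℝ) = 0 := by
  ext lam; simp [up]

theorem up_dotProduct (h : PartitionOf n → ℝ) (g : PartitionOf (n + 1) → ℝ) :
    up h ⬝ᵥ g = h ⬝ᵥ down g := by
  simp only [dotProduct, up, down, Finset.sum_mul, Finset.mul_sum]
  exact Finset.sum_comm' (by simp)

theorem dotProduct_up (h : PartitionOf n → ℝ) (g : PartitionOf (n + 1) → ℝ) :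
    g ⬝ᵥ up h = down g ⬝ᵥ h := by
  rw [dotProduct_comm, up_dotProduct, dotProduct_comm]

/-- The commutation relation `D U = 1 + U D` of Young's lattice. -/
theorem down_up (h : PartitionOf (n + 1) → ℝ) : down (up h) = h + up (down h) := by
  ext lam
  have h1 : down (up h) lam = ∑ lam', ((above lam ∩ above lam').card : ℝ) * h lam' := by
    simp only [down, up]
    rw [Finset.sum_comm' (t' := Finset.univ) (s' := fun lam' => above lam ∩ above lam')]
    · simp
    · simp
  have h2 : up (down h) lam = ∑ lam', ((below lam ∩ below lam').card : ℝ) * h lam' := by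
    simp only [down, up]
    rw [Finset.sum_comm' (t' := Finset.univ) (s' := fun lam' => below lam ∩ below lam')]
    · simp
    · simp
  have h3 : h lam = ∑ lam', (if lam' = lam then (1 : ℝ) else 0) * h lam' := by simp
  rw [Pi.add_apply, h1, h2]
  rw [h3]
  rw [← Finset.sum_add_distrib]
  refine Finset.sum_congr rfl fun lam' _ => ?_
  rw [← add_mul]
  congr 1
  split_ifs with heq
  · subst heq
    rw [Finset.inter_self, Finset.inter_self, card_above_eq_card_below_add_one]
    push_cast; ring
  · rw [card_above_inter_above (Ne.symm heq), zero_add]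

instance : Unique (PartitionOf 0) where
  default := ⟨⊥, by simp [YoungDiagram.card]⟩
  uniq lam := Subtype.ext (YoungDiagram.ext (by
    have : lam.1.cells.card = 0 := lam.2
    rw [Finset.card_eq_zero] at this
    rw [this, YoungDiagram.cells_bot]))

theorem removableRows_zero (lam : PartitionOf 0) : removableRows lam = ∅ := by
  simp [removableRows]

theorem down_up_zero (h : PartitionOf 0 → ℝ) : down (up h) = h := by
  ext lam
  have h1 : ∀ mu : PartitionOf 1, ∑ lam ∈ below mu, h lam = h lam := by
    intro mu
    have : below mu = {lam} := by
      ext nu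
      rw [Subsingleton.elim nu lam]
      simp only [mem_below, Finset.mem_singleton, iff_true]
      rw [Subsingleton.elim lam default]
      exact bot_le
    rw [this, Finset.sum_singleton]
  simp only [down, up, h1, Finset.sum_const, card_above, removableRows_zero]
  simp

end PartitionOf

/-! ### The branching rule for standard Young tableaux -/

namespace SYT

open PartitionOf

variable {n : ℕ} {lam : PartitionOf (n + 1)}

theorem card_cells (mu : PartitionOf n) : Fintype.card mu.1.cells = n := by
  rw [Fintype.card_coe]; exact mu.2

/-- The filling of `lam ⊢ n + 1` that extends a tableau of shape `mu ≤ lam` by the entry `n`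
(the largest one) in the additional cell. -/
def extendFun (mu : PartitionOf n) (T : SYT mu) (c : lam.1.cells) : Fin (n + 1) :=
  if h : c.1 ∈ mu.1.cells then (T.1 ⟨c.1, h⟩).castSucc else Fin.last n

theorem extendFun_injective {mu : PartitionOf n} (hmu : mu.1 ≤ lam.1) (T : SYT mu) :
    Function.Injective (extendFun (lam := lam) mu T) := by
  intro c d h
  obtain ⟨e, he, hd⟩ := exists_new_cell hmu
  unfold extendFun at h
  split_ifs at h with h1 h2 h2
  · have h3 := T.1.injective (Fin.castSucc_injective _ h)
    exact Subtype.ext (Subtype.mk.inj h3)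
  · exact absurd h (Fin.castSucc_lt_last _).ne
  · exact absurd h.symm (Fin.castSucc_lt_last _).ne
  · rw [YoungDiagram.mem_cells] at h1 h2
    have h3 := ((hd c.1).1 c.2).resolve_right h1
    have h4 := ((hd d.1).1 d.2).resolve_right h2
    exact Subtype.ext (h3.trans h4.symm)

/-- The tableau of shape `lam ⊢ n + 1` that extends a tableau of shape `mu ≤ lam` by the largest
entry in the additional cell. -/
noncomputable def extend {mu : PartitionOf n} (hmu : mu.1 ≤ lam.1) (T : SYT mu) : SYT lam :=
  ⟨Equiv.ofBijective (extendFun mu T)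
    ((Fintype.bijective_iff_injective_and_card _).2
      ⟨extendFun_injective hmu T, by rw [card_cells, Fintype.card_fin]⟩), by
    have key : ∀ c d : lam.1.cells, c.1.1 ≤ d.1.1 → c.1.2 ≤ d.1.2 → c ≠ d →
        (∀ hc hd, T.1 ⟨c.1, hc⟩ < T.1 ⟨d.1, hd⟩) →
        extendFun mu T c < extendFun mu T d := by
      intro c d h1 h2 hne hT
      have hcd : d.1 ∈ mu.1.cells → c.1 ∈ mu.1.cells := fun h => mu.1.up_left_mem h1 h2 h
      by_cases hd : d.1 ∈ mu.1.cells
      · simpa [extendFun, hd, hcd hd] using hT (hcd hd) hd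
      · have h3 : extendFun mu T d = Fin.last n := by simp [extendFun, hd]
        rw [h3]
        refine lt_of_le_of_ne (Fin.le_last _) fun h => hne ?_
        exact extendFun_injective hmu T (h.trans h3.symm)
    constructor
    · intro c d h1 h2
      exact key c d h1.le h2.le (fun h => by rw [h] at h2; omega)
        fun hc hd => T.2.1 ⟨c.1, hc⟩ ⟨d.1, hd⟩ h1 h2
    · intro c d h1 h2
      exact key c d h2.le h1.le (fun h => by rw [h] at h2; omega)
        fun hc hd => T.2.2 ⟨c.1, hc⟩ ⟨d.1, hd⟩ h1 h2⟩

variable {mu : PartitionOf n} (hmu : mu.1 ≤ lam.1) (T : SYT mu)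

theorem extend_apply_of_mem {c : lam.1.cells} (h : c.1 ∈ mu.1.cells) :
    (extend hmu T).1 c = (T.1 ⟨c.1, h⟩).castSucc := by
  change extendFun mu T c = _
  simp [extendFun, h]

theorem extend_apply_of_notMem {c : lam.1.cells} (h : c.1 ∉ mu.1.cells) :
    (extend hmu T).1 c = Fin.last n := by
  change extendFun mu T c = _
  simp [extendFun, h]

theorem extend_symm_castSucc (k : Fin n) :
    ((extend hmu T).1.symm k.castSucc).1 = (T.1.symm k).1 := by
  have h1 : (extend hmu T).1.symm k.castSucc =
      ⟨(T.1.symm k).1, YoungDiagram.cells_subset_iff.2 hmu (T.1.symm k).2⟩ := by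
    rw [Equiv.symm_apply_eq, extend_apply_of_mem hmu T (T.1.symm k).2]
    simp
  rw [h1]

theorem extend_symm_last_notMem :
    ((extend hmu T).1.symm (Fin.last n)).1 ∉ mu.1.cells := by
  intro h
  have h1 := extend_apply_of_mem hmu T h
  rw [Equiv.apply_symm_apply] at h1
  exact (Fin.castSucc_lt_last _).ne h1.symm

theorem row_extend_castSucc (k : Fin n) : (extend hmu T).row k.castSucc = T.row k := by
  rw [row, row, extend_symm_castSucc]

theorem col_extend_castSucc (k : Fin n) : (extend hmu T).col k.castSucc = T.col k := by
  rw [col, col, extend_symm_castSucc]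

theorem content_extend_castSucc (k : Fin n) :
    (extend hmu T).content k.castSucc = T.content k := by
  rw [content, content, row_extend_castSucc, col_extend_castSucc]

theorem extend_injective : Function.Injective (extend hmu) := by
  intro T S h
  refine Subtype.ext (Equiv.ext fun c => ?_)
  have hc : c.1 ∈ lam.1.cells := YoungDiagram.cells_subset_iff.2 hmu c.2
  have h1 := extend_apply_of_mem hmu T (c := ⟨c.1, hc⟩) c.2
  rw [h, extend_apply_of_mem hmu S (c := ⟨c.1, hc⟩) c.2] at h1
  exact (Fin.castSucc_injective _ h1).symm

/-- The shape of the entries other than the largest is determined by the cell of the largest. -/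
theorem eq_of_extend_symm_last_eq {mu' : PartitionOf n} (hmu' : mu'.1 ≤ lam.1) (T' : SYT mu')
    (h : (extend hmu T).1.symm (Fin.last n) = (extend hmu' T').1.symm (Fin.last n)) :
    mu = mu' := by
  have key : ∀ (nu : PartitionOf n) (hnu : nu.1 ≤ lam.1) (S : SYT nu) (c : ℕ × ℕ),
      c ∈ nu.1 ↔ ∃ hc : c ∈ lam.1.cells, ⟨c, hc⟩ ≠ (extend hnu S).1.symm (Fin.last n) := by
    intro nu hnu S c
    constructor
    · intro hc
      refine ⟨YoungDiagram.cells_subset_iff.2 hnu hc, fun h1 => extend_symm_last_notMem hnu S ?_⟩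
      rw [← h1]
      exact hc
    · rintro ⟨hc, h1⟩
      by_contra h2
      exact h1 (by rw [Equiv.eq_symm_apply]; exact extend_apply_of_notMem hnu S h2)
  refine Subtype.ext (SetLike.ext fun c => ?_)
  rw [key mu hmu T, key mu' hmu' T', h]

theorem exists_extend_eq (T : SYT lam) :
    ∃ (mu : PartitionOf n) (hmu : mu.1 ≤ lam.1) (S : SYT mu), extend hmu S = T := by
  set c := T.1.symm (Fin.last n) with hc
  have hTc : T.1 c = Fin.last n := by rw [hc, Equiv.apply_symm_apply]
  have hmax : ∀ d : lam.1.cells, d ≠ c → T.1 d ≠ Fin.last n := fun d hd h =>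
    hd (T.1.injective (h.trans hTc.symm))
  have hlow : IsLowerSet (lam.1.cells.erase c.1 : Set (ℕ × ℕ)) := by
    rintro ⟨a, b⟩ ⟨a', b'⟩ hle h
    obtain ⟨hle1, hle2⟩ := Prod.mk_le_mk.1 hle
    simp only [Finset.coe_erase, Set.mem_sdiff, Finset.mem_coe, Set.mem_singleton_iff] at h ⊢
    have hd' : (a', b') ∈ lam.1.cells := lam.1.up_left_mem hle1 hle2 h.1
    refine ⟨hd', fun heq => ?_⟩
    have hmid : (a', b) ∈ lam.1.cells := lam.1.up_left_mem hle1 le_rfl h.1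
    have h1 : T.1 ⟨(a', b'), hd'⟩ = Fin.last n := by
      rw [← hTc]; exact congrArg _ (Subtype.ext heq)
    rcases hle1.eq_or_lt with rfl | hlt
    · rcases hle2.eq_or_lt with rfl | hlt2
      · exact h.2 heq
      · have := T.2.1 ⟨(a', b'), hd'⟩ ⟨(a', b), h.1⟩ rfl hlt2
        rw [h1] at this
        exact absurd this (not_lt.2 (Fin.le_last _))
    · have h2 := T.2.2 ⟨(a', b), hmid⟩ ⟨(a, b), h.1⟩ rfl hlt
      rcases hle2.eq_or_lt with rfl | hlt2
      · rw [h1] at h2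
        exact absurd h2 (not_lt.2 (Fin.le_last _))
      · have := T.2.1 ⟨(a', b'), hd'⟩ ⟨(a', b), hmid⟩ rfl hlt2
        rw [h1] at this
        exact absurd this (not_lt.2 (Fin.le_last _))
  have hcard : (lam.1.cells.erase c.1).card = n := by
    have h3 : lam.1.cells.card = n + 1 := lam.2
    rw [Finset.card_erase_of_mem c.2, h3, Nat.add_sub_cancel]
  let mu : PartitionOf n := ⟨⟨lam.1.cells.erase c.1, hlow⟩, hcard⟩
  have hsub : ∀ d : mu.1.cells, d.1 ∈ lam.1.cells := fun d => Finset.mem_of_mem_erase d.2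
  have hne : ∀ d : mu.1.cells, (⟨d.1, hsub d⟩ : lam.1.cells) ≠ c := fun d h =>
    Finset.ne_of_mem_erase d.2 (congrArg Subtype.val h)
  let f : mu.1.cells → Fin n := fun d => (T.1 ⟨d.1, hsub d⟩).castPred (hmax _ (hne d))
  have hf : Function.Injective f := by
    intro d d' h
    have h1 := T.1.injective (Fin.castPred_inj.1 h)
    exact Subtype.ext (Subtype.mk.inj h1)
  let S : SYT mu := ⟨Equiv.ofBijective f ((Fintype.bijective_iff_injective_and_card _).2
      ⟨hf, by rw [card_cells, Fintype.card_fin]⟩),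
    fun d d' h1 h2 => Fin.lt_def.2 (Fin.lt_def.1 (T.2.1 ⟨d.1, hsub d⟩ ⟨d'.1, hsub d'⟩ h1 h2)),
    fun d d' h1 h2 => Fin.lt_def.2 (Fin.lt_def.1 (T.2.2 ⟨d.1, hsub d⟩ ⟨d'.1, hsub d'⟩ h1 h2))⟩
  have hmu : mu.1 ≤ lam.1 := fun d hd => hsub ⟨d, hd⟩
  refine ⟨mu, hmu, S, Subtype.ext (Equiv.ext fun d => ?_)⟩
  by_cases hd : d.1 ∈ mu.1.cells
  · rw [extend_apply_of_mem hmu S hd]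
    exact Fin.castSucc_castPred _ (hmax _ (hne ⟨d.1, hd⟩))
  · rw [extend_apply_of_notMem hmu S hd, ← hTc]
    congr 1
    by_contra h
    exact hd (Finset.mem_erase.2 ⟨fun h' => h (Subtype.ext h').symm, d.2⟩)

/-- The branching rule: a standard Young tableau of shape `lam ⊢ n + 1` is a tableau of shape `mu`
for some `mu` obtained from `lam` by removing a cell. -/
noncomputable def branchEquiv (lam : PartitionOf (n + 1)) :
    (Σ mu : below lam, SYT mu.1) ≃ SYT lam :=
  Equiv.ofBijective (fun p => extend (mem_below.1 p.1.2) p.2) (by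
    constructor
    · rintro ⟨⟨mu, hmu⟩, T⟩ ⟨⟨mu', hmu'⟩, T'⟩ h
      obtain rfl : mu = mu' := eq_of_extend_symm_last_eq (mem_below.1 hmu) T (mem_below.1 hmu') T'
        (by simp only at h; rw [h])
      obtain rfl : T = T' := extend_injective (mem_below.1 hmu) h
      rfl
    · intro T
      obtain ⟨mu, hmu, S, h⟩ := exists_extend_eq T
      exact ⟨⟨⟨mu, mem_below.2 hmu⟩, S⟩, h⟩)

theorem branchEquiv_apply (lam : PartitionOf (n + 1)) (mu : below lam) (T : SYT mu.1) :
    branchEquiv lam ⟨mu, T⟩ = extend (mem_below.1 mu.2) T := rfl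

end SYT

namespace PartitionOf

/-- The dimension `dim lam`, as a real function on the partitions of `n`. -/
noncomputable def dimFun (n : ℕ) (lam : PartitionOf n) : ℝ := dimSYT lam

theorem dimFun_nonneg (n : ℕ) (lam : PartitionOf n) : 0 ≤ dimFun n lam := Nat.cast_nonneg _

theorem dimFun_succ (n : ℕ) : dimFun (n + 1) = up (dimFun n) := by
  ext lam
  rw [dimFun, dimSYT, ← Fintype.card_congr (SYT.branchEquiv lam), Fintype.card_sigma, up,
    ← Finset.sum_coe_sort (below lam)]
  push_cast
  rfl

theorem dimFun_zero : dimFun 0 = 1 := by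
  ext lam
  have hc : IsEmpty lam.1.cells := by
    rw [← Fintype.card_eq_zero_iff, SYT.card_cells]
  have : Fintype.card (SYT lam) = 1 := by
    rw [Fintype.card_eq_one_iff]
    exact ⟨⟨Equiv.equivOfIsEmpty _ _, fun c => isEmptyElim c, fun c => isEmptyElim c⟩,
      fun T => Subtype.ext (Equiv.ext fun c => isEmptyElim c)⟩
  simp [dimFun, dimSYT, this]

theorem down_dimFun (n : ℕ) : down (dimFun (n + 1)) = ((n : ℝ) + 1) • dimFun n := by
  induction n with
  | zero => rw [dimFun_succ, down_up_zero]; simp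
  | succ n ih =>
    rw [dimFun_succ (n + 1), down_up, ih, up_smul, ← dimFun_succ]
    push_cast
    module

theorem dimFun_dotProduct_up (n : ℕ) (h : PartitionOf n → ℝ) :
    dimFun (n + 1) ⬝ᵥ up h = ((n : ℝ) + 1) * (dimFun n ⬝ᵥ h) := by
  rw [dotProduct_up, down_dimFun, smul_dotProduct, smul_eq_mul]

theorem dimFun_dotProduct_self (n : ℕ) : dimFun n ⬝ᵥ dimFun n = (n.factorial : ℝ) := by
  induction n with
  | zero => rw [dimFun_zero]; simp [dotProduct]
  | succ n ih =>
    nth_rewrite 2 [dimFun_succ]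
    rw [dimFun_dotProduct_up, ih, Nat.factorial_succ]
    push_cast; ring

end PartitionOf

/-! ### Restriction of Young's orthogonal representation to the preceding symmetric group -/

section ExtendPerm

variable {n : ℕ}

theorem extendPerm_castLE {r : ℕ} (h : r ≤ n) (σ : Equiv.Perm (Fin r)) (x : Fin r) :
    extendPerm h σ (x.castLE h) = (σ x).castLE h :=
  Equiv.Perm.viaFintypeEmbedding_apply_image σ (Fin.castLEEmb h) x

theorem extendPerm_of_le {r : ℕ} (h : r ≤ n) (σ : Equiv.Perm (Fin r)) (x : Fin n)
    (hx : r ≤ x.1) : extendPerm h σ x = x := by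
  apply Equiv.Perm.viaFintypeEmbedding_apply_notMem_range
  rintro ⟨y, rfl⟩
  exact absurd y.2 (not_lt.2 hx)

theorem extendPerm_last (σ : Equiv.Perm (Fin n)) :
    extendPerm n.le_succ σ (Fin.last n) = Fin.last n :=
  extendPerm_of_le n.le_succ σ (Fin.last n) (le_refl n)

/-- A permutation that fixes all points from `r` on and acts as `σ` below `r` is `σ` extended. -/
theorem eq_extendPerm {r : ℕ} (h : r ≤ n) (σ : Equiv.Perm (Fin r)) (τ : Equiv.Perm (Fin n))
    (h1 : ∀ x : Fin r, τ (x.castLE h) = (σ x).castLE h) (h2 : ∀ x : Fin n, r ≤ x.1 → τ x = x) :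
    τ = extendPerm h σ := by
  ext x : 1
  rcases lt_or_ge x.1 r with hx | hx
  · have : x = Fin.castLE h ⟨x.1, hx⟩ := rfl
    rw [this, h1, extendPerm_castLE]
  · rw [h2 x hx, extendPerm_of_le h σ x hx]

theorem extendPerm_mul {r : ℕ} (h : r ≤ n) (σ τ : Equiv.Perm (Fin r)) :
    extendPerm h (σ * τ) = extendPerm h σ * extendPerm h τ := by
  symm
  apply eq_extendPerm
  · intro x
    simp only [Equiv.Perm.mul_apply, extendPerm_castLE]
  · intro x hx
    rw [Equiv.Perm.mul_apply, extendPerm_of_le h τ x hx, extendPerm_of_le h σ x hx]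

theorem extendPerm_one {r : ℕ} (h : r ≤ n) : extendPerm h (1 : Equiv.Perm (Fin r)) = 1 := by
  symm
  apply eq_extendPerm <;> simp

theorem extendPerm_inv {r : ℕ} (h : r ≤ n) (σ : Equiv.Perm (Fin r)) :
    extendPerm h σ⁻¹ = (extendPerm h σ)⁻¹ := by
  rw [eq_inv_iff_mul_eq_one, ← extendPerm_mul, inv_mul_cancel, extendPerm_one]

theorem extendPerm_self (σ : Equiv.Perm (Fin n)) : extendPerm le_rfl σ = σ := by
  symm
  apply eq_extendPerm
  · intro x; rfl
  · intro x hx; exact absurd x.2 (not_lt.2 hx)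

theorem extendPerm_succ {r : ℕ} (h : r ≤ n) (σ : Equiv.Perm (Fin r)) :
    extendPerm (h.trans n.le_succ) σ = extendPerm n.le_succ (extendPerm h σ) := by
  apply eq_extendPerm
  · intro x
    rcases lt_or_ge x.1 r with hx | hx
    · have : x = Fin.castLE h ⟨x.1, hx⟩ := rfl
      rw [this, extendPerm_castLE]
      exact extendPerm_castLE _ σ ⟨x.1, hx⟩
    · rw [extendPerm_of_le h σ x hx, extendPerm_of_le _ σ _ (by exact hx)]
  · intro x hx
    exact extendPerm_of_le _ σ x (h.trans hx)

/-- An adjacent transposition of `n` points, as one of `n + 1` points. -/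
def castAdj (k : AdjIndex n) : AdjIndex (n + 1) := ⟨k.1, Nat.lt_succ_of_lt k.2⟩

theorem adjSwap_castAdj (k : AdjIndex n) :
    adjSwap (castAdj k) = extendPerm n.le_succ (adjSwap k) := by
  apply eq_extendPerm
  · intro x
    exact (Fin.castLE_injective n.le_succ).swap_apply ⟨k.1, Nat.lt_of_succ_lt k.2⟩ ⟨k.1 + 1, k.2⟩ x
  · intro x hx
    have := k.2
    apply Equiv.swap_apply_of_ne_of_ne
    · intro e; rw [e] at hx; simp only [castAdj] at hx; omega
    · intro e; rw [e] at hx; simp only [castAdj] at hx; omega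

theorem prod_adjSwap_castAdj (w : List (AdjIndex n)) :
    ((w.map castAdj).map adjSwap).prod = extendPerm n.le_succ (w.map adjSwap).prod := by
  induction w with
  | nil => simp [extendPerm_one]
  | cons k w ih => simp only [List.map_cons, List.prod_cons, ih, adjSwap_castAdj, extendPerm_mul]

theorem ascendingWord_succ (m j : ℕ) (h : j < n) :
    ascendingWord (n := n + 1) m j (Nat.lt_succ_of_lt h) = (ascendingWord m j h).map castAdj := by
  rw [ascendingWord, ascendingWord, List.map_ofFn]
  rfl

theorem adjWordAux_succ (j : ℕ) (h : j ≤ n) (σ : Equiv.Perm (Fin n)) :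
    adjWordAux (n := n + 1) j (Nat.le_succ_of_le h) (extendPerm n.le_succ σ) =
      (adjWordAux j h σ).map castAdj := by
  induction j generalizing σ with
  | zero => rfl
  | succ j ih =>
    have h1 : (extendPerm n.le_succ σ ⟨j, Nat.le_succ_of_le h⟩).1 = (σ ⟨j, h⟩).1 :=
      congrArg Fin.val (extendPerm_castLE n.le_succ σ ⟨j, h⟩)
    rw [adjWordAux, adjWordAux, h1, ascendingWord_succ _ _ h, prod_adjSwap_castAdj,
      ← extendPerm_inv, ← extendPerm_mul, ih, List.map_append]

/-- The chosen decomposition into adjacent transpositions does not change when a permutation is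
regarded as one of more points. -/
theorem adjWord_succ (σ : Equiv.Perm (Fin n)) :
    adjWord (extendPerm n.le_succ σ) = (adjWord σ).map castAdj := by
  have h1 : (extendPerm n.le_succ σ ⟨n, Nat.lt_succ_self n⟩).1 = n :=
    congrArg Fin.val (extendPerm_last σ)
  have h2 : ascendingWord (n := n + 1) n n (Nat.lt_succ_self n) = [] := by
    rw [← List.length_eq_zero_iff, ascendingWord, List.length_ofFn, Nat.sub_self]
  rw [adjWord, adjWordAux, h1, h2, List.nil_append, List.map_nil, List.prod_nil, inv_one, one_mul]
  exact adjWordAux_succ n le_rfl σ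

theorem length_adjWord_extendPerm {r : ℕ} (h : r ≤ n) (σ : Equiv.Perm (Fin r)) :
    (adjWord (extendPerm h σ)).length = (adjWord σ).length := by
  induction n, h using Nat.le_induction with
  | base => rw [extendPerm_self]
  | succ n h ih => rw [extendPerm_succ h, adjWord_succ, List.length_map, ih]

end ExtendPerm

section Branching

open PartitionOf SYT

variable {n : ℕ} (ε : ℤˣ) (lam : PartitionOf (n + 1))

theorem youngDist_extend {mu : PartitionOf n} (hmu : mu.1 ≤ lam.1) (T : SYT mu) (k : AdjIndex n) :
    youngDist ε (extend hmu T) (castAdj k) = youngDist ε T k := by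
  unfold youngDist
  congr 2
  · exact content_extend_castSucc hmu T ⟨k.1, Nat.lt_of_succ_lt k.2⟩
  · exact content_extend_castSucc hmu T ⟨k.1 + 1, k.2⟩

theorem extend_eq_trans_adjSwap_iff {mu : PartitionOf n} (hmu : mu.1 ≤ lam.1) (T S : SYT mu)
    (k : AdjIndex n) :
    (extend hmu S).1 = (extend hmu T).1.trans (adjSwap (castAdj k)) ↔
      S.1 = T.1.trans (adjSwap k) := by
  rw [adjSwap_castAdj]
  constructor
  · intro h
    ext1 c
    have hc : c.1 ∈ lam.1.cells := YoungDiagram.cells_subset_iff.2 hmu c.2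
    have h1 := Equiv.congr_fun h ⟨c.1, hc⟩
    rw [Equiv.trans_apply, extend_apply_of_mem hmu S (c := ⟨c.1, hc⟩) c.2,
      extend_apply_of_mem hmu T (c := ⟨c.1, hc⟩) c.2] at h1
    have h2 := h1.trans (extendPerm_castLE n.le_succ (adjSwap k) (T.1 c))
    exact Fin.castSucc_injective _ h2
  · intro h
    ext1 c
    rw [Equiv.trans_apply]
    by_cases hc : c.1 ∈ mu.1.cells
    · rw [extend_apply_of_mem hmu S hc, extend_apply_of_mem hmu T hc, h]
      exact (extendPerm_castLE n.le_succ (adjSwap k) (T.1 ⟨c.1, hc⟩)).symm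
    · rw [extend_apply_of_notMem hmu S hc, extend_apply_of_notMem hmu T hc,
        extendPerm_last]

theorem eq_of_extend_eq_trans_adjSwap {mu mu' : PartitionOf n} (hmu : mu.1 ≤ lam.1)
    (hmu' : mu'.1 ≤ lam.1) (T : SYT mu) (S : SYT mu') (k : AdjIndex n)
    (h : (extend hmu' S).1 = (extend hmu T).1.trans (adjSwap (castAdj k))) : mu = mu' := by
  apply eq_of_extend_symm_last_eq hmu T hmu' S
  rw [h, Equiv.symm_trans_apply, adjSwap_castAdj]
  congr 1
  rw [Equiv.eq_symm_apply, extendPerm_last]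

theorem youngGenerator_castAdj (k : AdjIndex n) :
    youngGenerator ε lam (castAdj k) = Matrix.reindexAlgEquiv ℝ ℝ (branchEquiv lam)
      (Matrix.blockDiagonal' fun mu : below lam => youngGenerator ε mu.1 k) := by
  ext T S
  obtain ⟨⟨mu, T⟩, rfl⟩ := (branchEquiv lam).surjective T
  obtain ⟨⟨mu', S⟩, rfl⟩ := (branchEquiv lam).surjective S
  rw [Matrix.coe_reindexAlgEquiv, Matrix.reindex_apply, Matrix.submatrix_apply,
    Equiv.symm_apply_apply, Equiv.symm_apply_apply]
  by_cases hne : mu = mu'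
  · subst hne
    rw [Matrix.blockDiagonal'_apply_eq]
    simp only [youngGenerator, Matrix.of_apply, branchEquiv_apply, youngDist_extend,
      extend_eq_trans_adjSwap_iff, (extend_injective (mem_below.1 mu.2)).eq_iff]
  · rw [Matrix.blockDiagonal'_apply_ne _ _ _ hne, youngGenerator, Matrix.of_apply, if_neg, if_neg]
    · exact fun h => hne (Subtype.ext (eq_of_extend_eq_trans_adjSwap lam
        (mem_below.1 mu.2) (mem_below.1 mu'.2) T S k h))
    · exact fun h => hne (congrArg Sigma.fst ((branchEquiv lam).injective h))

/-- The branching rule for Young's orthogonal representation: restricted to permutations that fix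
the last point, it is block diagonal. -/
theorem youngOrthogonal_extendPerm (σ : Equiv.Perm (Fin n)) :
    youngOrthogonal ε lam (extendPerm n.le_succ σ) =
      Matrix.reindexAlgEquiv ℝ ℝ (branchEquiv lam)
        (Matrix.blockDiagonal' fun mu : below lam => youngOrthogonal ε mu.1 σ) := by
  unfold youngOrthogonal
  rw [adjWord_succ]
  induction adjWord σ with
  | nil =>
    simp only [List.map_nil, List.prod_nil]
    change _ = Matrix.reindexAlgEquiv ℝ ℝ (branchEquiv lam) (Matrix.blockDiagonal' 1)
    rw [Matrix.blockDiagonal'_one, Matrix.coe_reindexAlgEquiv, Matrix.reindex_apply,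
      Matrix.submatrix_one_equiv]
  | cons k w ih =>
    simp only [List.map_cons, List.prod_cons]
    rw [Matrix.blockDiagonal'_mul, map_mul, ← ih, youngGenerator_castAdj]

theorem youngOrthogonal_branch_eq (σ : Equiv.Perm (Fin n)) (mu : below lam) (T S : SYT mu.1) :
    youngOrthogonal ε lam (extendPerm n.le_succ σ) (branchEquiv lam ⟨mu, T⟩)
      (branchEquiv lam ⟨mu, S⟩) = youngOrthogonal ε mu.1 σ T S := by
  rw [youngOrthogonal_extendPerm, Matrix.coe_reindexAlgEquiv, Matrix.reindex_apply,
    Matrix.submatrix_apply, Equiv.symm_apply_apply, Equiv.symm_apply_apply,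
    Matrix.blockDiagonal'_apply_eq]

theorem youngOrthogonal_branch_ne (σ : Equiv.Perm (Fin n)) {mu mu' : below lam} (hne : mu ≠ mu')
    (T : SYT mu.1) (S : SYT mu'.1) :
    youngOrthogonal ε lam (extendPerm n.le_succ σ) (branchEquiv lam ⟨mu, T⟩)
      (branchEquiv lam ⟨mu', S⟩) = 0 := by
  rw [youngOrthogonal_extendPerm, Matrix.coe_reindexAlgEquiv, Matrix.reindex_apply,
    Matrix.submatrix_apply, Equiv.symm_apply_apply, Equiv.symm_apply_apply,
    Matrix.blockDiagonal'_apply_ne _ _ _ hne]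

/-- A sum of entries of the representation matrix over a product `p × q` of sets of tableaux splits
into sums over the blocks of the branching rule. -/
theorem sum_youngOrthogonal_branch (σ : Equiv.Perm (Fin n)) (p q : SYT lam → Prop)
    [DecidablePred p] [DecidablePred q] :
    ∑ T with p T, ∑ S with q S, youngOrthogonal ε lam (extendPerm n.le_succ σ) T S =
      ∑ mu : below lam, ∑ T with p (branchEquiv lam ⟨mu, T⟩),
        ∑ S with q (branchEquiv lam ⟨mu, S⟩), youngOrthogonal ε mu.1 σ T S := by
  simp only [Finset.sum_filter]
  rw [← (branchEquiv lam).sum_comp, Fintype.sum_sigma]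
  refine Finset.sum_congr rfl fun mu _ => Finset.sum_congr rfl fun T _ => ?_
  congr 1
  rw [← (branchEquiv lam).sum_comp, Fintype.sum_sigma, Finset.sum_eq_single mu]
  · simp only [youngOrthogonal_branch_eq]
  · intro mu' _ hne
    simp only [youngOrthogonal_branch_ne ε lam σ hne.symm, ite_self, Finset.sum_const_zero]
  · simp

end Branching

section EntrySum

variable {n : ℕ} (ε : ℤˣ)

/-- The sum of all entries of the matrix `π^lam(σ)`. -/
noncomputable def entrySum (σ : Equiv.Perm (Fin n)) (lam : PartitionOf n) : ℝ :=
  ∑ T, ∑ S, youngOrthogonal ε lam σ T S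

theorem entrySum_succ (σ : Equiv.Perm (Fin n)) :
    entrySum ε (extendPerm n.le_succ σ) = PartitionOf.up (entrySum ε σ) := by
  ext lam
  have h := sum_youngOrthogonal_branch ε lam σ (fun _ => True) (fun _ => True)
  simp only [Finset.filter_true] at h
  rw [entrySum, h, PartitionOf.up]
  exact Finset.sum_coe_sort (PartitionOf.below lam) (entrySum ε σ)

theorem totalSum_eq (lam : PartitionOf n) (σ : Equiv.Perm (Fin n)) :
    totalSum ε lam σ = entrySum ε σ lam / dimSYT lam := by
  simp only [totalSum, entrySum, Finset.sum_div]

theorem dimFun_mul_totalSum (lam : PartitionOf n) (σ : Equiv.Perm (Fin n)) :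
    PartitionOf.dimFun n lam * totalSum ε lam σ = entrySum ε σ lam := by
  rw [totalSum_eq, PartitionOf.dimFun]
  rcases Nat.eq_zero_or_pos (dimSYT lam) with h | h
  · have : IsEmpty (SYT lam) := Fintype.card_eq_zero_iff.1 h
    simp [entrySum]
  · field_simp

theorem youngGenerator_abs_sum_le (lam : PartitionOf n) (k : AdjIndex n) (T : SYT lam) :
    ∑ S, |youngGenerator ε lam k T S| ≤ 2 := by
  have h1 : ∀ S, |youngGenerator ε lam k T S| ≤
      (if T = S then 1 else 0) + (if S.1 = T.1.trans (adjSwap k) then 1 else 0) := by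
    intro S
    simp only [youngGenerator, Matrix.of_apply]
    by_cases hTS : T = S
    · rw [if_pos hTS, if_pos hTS, abs_div, abs_one]
      have h2 : (1 : ℝ) / |(youngDist ε T k : ℝ)| ≤ 1 := by
        -- The case of distance `0` does not occur, but `1 / 0 = 0` makes it harmless.
        rcases eq_or_ne (youngDist ε T k) 0 with h0 | h0
        · simp [h0]
        · rw [div_le_one (abs_pos.2 (Int.cast_ne_zero.2 h0))]
          exact_mod_cast Int.one_le_abs h0
      split_ifs <;> linarith
    · rw [if_neg hTS, if_neg hTS, zero_add]
      split_ifs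
      · rw [abs_of_nonneg (Real.sqrt_nonneg _), Real.sqrt_le_one]
        have : 0 ≤ 1 / (youngDist ε T k : ℝ) ^ 2 := by positivity
        linarith
      · simp
  refine (Finset.sum_le_sum fun S _ => h1 S).trans ?_
  rw [Finset.sum_add_distrib, Finset.sum_ite_eq, if_pos (Finset.mem_univ _), Finset.sum_boole]
  have h2 : (Finset.univ.filter fun S : SYT lam => S.1 = T.1.trans (adjSwap k)).card ≤ 1 := by
    rw [Finset.card_le_one]
    intro S hS S' hS'
    exact Subtype.ext ((Finset.mem_filter.1 hS).2.trans (Finset.mem_filter.1 hS').2.symm)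
  have h3 : ((Finset.univ.filter fun S : SYT lam => S.1 = T.1.trans (adjSwap k)).card : ℝ) ≤ 1 := by
    exact_mod_cast h2
  linarith

theorem youngOrthogonal_abs_sum_le (lam : PartitionOf n) (σ : Equiv.Perm (Fin n)) (T : SYT lam) :
    ∑ S, |youngOrthogonal ε lam σ T S| ≤ 2 ^ (adjWord σ).length := by
  unfold youngOrthogonal
  induction adjWord σ generalizing T with
  | nil => simp [Matrix.one_apply, apply_ite abs]
  | cons k w ih =>
    simp only [List.map_cons, List.prod_cons, Matrix.mul_apply, List.length_cons]
    calc ∑ S, |∑ R, youngGenerator ε lam k T R * (w.map (youngGenerator ε lam)).prod R S|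
        ≤ ∑ S, ∑ R, |youngGenerator ε lam k T R| * |(w.map (youngGenerator ε lam)).prod R S| := by
          refine Finset.sum_le_sum fun S _ => (Finset.abs_sum_le_sum_abs _ _).trans_eq ?_
          simp only [abs_mul]
      _ = ∑ R, |youngGenerator ε lam k T R| * ∑ S, |(w.map (youngGenerator ε lam)).prod R S| := by
          rw [Finset.sum_comm]
          simp only [Finset.mul_sum]
      _ ≤ ∑ R, |youngGenerator ε lam k T R| * 2 ^ w.length :=
          Finset.sum_le_sum fun R _ => mul_le_mul_of_nonneg_left (ih R) (abs_nonneg _)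
      _ ≤ 2 * 2 ^ w.length := by
          rw [← Finset.sum_mul]
          exact mul_le_mul_of_nonneg_right (youngGenerator_abs_sum_le ε lam k T) (by positivity)
      _ = 2 ^ (w.length + 1) := by ring

/-- A bound on the partial sums of entries that is uniform in the shape: the row sums of the
absolute values of the entries are bounded in terms of the word that represents `σ`. -/
theorem abs_sum_youngOrthogonal_le (lam : PartitionOf n) (σ : Equiv.Perm (Fin n))
    (A B : Finset (SYT lam)) :
    |∑ T ∈ A, ∑ S ∈ B, youngOrthogonal ε lam σ T S| ≤
      2 ^ (adjWord σ).length * PartitionOf.dimFun n lam := by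
  calc |∑ T ∈ A, ∑ S ∈ B, youngOrthogonal ε lam σ T S|
      ≤ ∑ T ∈ A, ∑ S ∈ B, |youngOrthogonal ε lam σ T S| :=
        (Finset.abs_sum_le_sum_abs _ _).trans
          (Finset.sum_le_sum fun T _ => Finset.abs_sum_le_sum_abs _ _)
    _ ≤ ∑ T : SYT lam, ∑ S, |youngOrthogonal ε lam σ T S| := by
        refine (Finset.sum_le_sum fun T _ => Finset.sum_le_univ_sum_of_nonneg
          fun S => abs_nonneg _).trans (Finset.sum_le_univ_sum_of_nonneg
          fun T => Finset.sum_nonneg fun S _ => abs_nonneg _)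
    _ ≤ ∑ _T : SYT lam, (2 : ℝ) ^ (adjWord σ).length :=
        Finset.sum_le_sum fun T _ => youngOrthogonal_abs_sum_le ε lam σ T
    _ = 2 ^ (adjWord σ).length * PartitionOf.dimFun n lam := by
        rw [Finset.sum_const, nsmul_eq_mul, mul_comm]
        rfl

end EntrySum

/-! ### Decay of the orbits of the up operator orthogonal to the dimension function -/

namespace PartitionOf

/-- Let `h (n + 1) = U (h n)` for `n ≥ r`, where `h r` is orthogonal to the dimension function. Then
the squared norm of `h n` is `O(n! / n)`. The proof is by induction on `r`. By the commutation
relation, `D (h (n + 1)) = (n + 1 - r) h n + g n`, where `g` is again an orbit of the up operator,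
starts at `g (r - 1) = D (h r)`, and is orthogonal to the dimension function there. -/
theorem exists_orbit_bound (r : ℕ) (h : ∀ n, PartitionOf n → ℝ)
    (hup : ∀ n, r ≤ n → h (n + 1) = up (h n)) (horth : dimFun r ⬝ᵥ h r = 0) :
    ∃ C : ℝ, ∀ n, r ≤ n → h (n + 1) ⬝ᵥ h (n + 1) ≤ C * n.factorial := by
  -- There is one partition of `0`, of dimension `1`, so that orthogonality means vanishing.
  have hzero : ∀ g : ∀ n, PartitionOf n → ℝ, (∀ n, 0 ≤ n → g (n + 1) = up (g n)) →
      dimFun 0 ⬝ᵥ g 0 = 0 → ∀ n, g n = 0 := by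
    intro g hg h0 n
    induction n with
    | zero =>
      ext lam
      rw [Subsingleton.elim lam default]
      simpa [dotProduct, dimFun_zero] using h0
    | succ n ih => rw [hg n (Nat.zero_le n), ih, up_zero]
  induction r generalizing h with
  | zero =>
    refine ⟨0, fun n _ => ?_⟩
    rw [hzero h hup horth]
    simp
  | succ r ih =>
    set g : ∀ n, PartitionOf n → ℝ := fun n => down (h (n + 1)) - ((n : ℝ) - r) • h n with hg
    -- At `n = r` the coefficient vanishes, so that `U (h r)` need not be `h (r + 1)`.
    have hgup : ∀ n, r ≤ n → g (n + 1) = up (g n) := by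
      intro n hn
      have h1 : down (h (n + 2)) = h (n + 1) + up (down (h (n + 1))) := by
        rw [hup (n + 1) (by omega), down_up]
      have h2 : ((n : ℝ) - r) • up (h n) = ((n : ℝ) - r) • h (n + 1) := by
        rcases hn.eq_or_lt with rfl | hlt
        · rw [sub_self, zero_smul, zero_smul]
        · rw [hup n hlt]
      simp only [hg, up_sub, up_smul, h1, h2]
      push_cast
      module
    have hgorth : dimFun r ⬝ᵥ g r = 0 := by
      simp only [hg, sub_self, zero_smul, sub_zero]
      rw [← up_dotProduct, ← dimFun_succ, horth]
    have hstep : ∀ n, r + 1 ≤ n →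
        h (n + 1) ⬝ᵥ h (n + 1) = ((n : ℝ) - r) * (h n ⬝ᵥ h n) + h n ⬝ᵥ g n := by
      intro n hn
      have h1 : down (h (n + 1)) = ((n : ℝ) - r) • h n + g n := by simp only [hg]; module
      nth_rewrite 1 [hup n hn]
      rw [up_dotProduct, h1, dotProduct_add, dotProduct_smul, smul_eq_mul]
    obtain ⟨C', hC'⟩ := ih g hgup hgorth
    have hfac : ∀ n : ℕ, (0 : ℝ) < n.factorial := fun n => Nat.cast_pos.2 n.factorial_pos
    set C := max C' (h (r + 2) ⬝ᵥ h (r + 2)) with hC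
    have hA : ∀ n, 0 ≤ h n ⬝ᵥ h n := fun n => Finset.sum_nonneg fun i _ => mul_self_nonneg _
    have hCnn : 0 ≤ C := (hA _).trans (le_max_right _ _)
    have hAM : ∀ n, 2 * (h n ⬝ᵥ g n) ≤ h n ⬝ᵥ h n + g n ⬝ᵥ g n := by
      intro n
      simp only [dotProduct, Finset.mul_sum, ← Finset.sum_add_distrib]
      refine Finset.sum_le_sum fun i _ => ?_
      nlinarith [sq_nonneg (h n i - g n i)]
    refine ⟨C, fun n hn => ?_⟩
    induction n, hn using Nat.le_induction with
    | base =>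
      have h1 : (1 : ℝ) ≤ (r + 1).factorial := by
        exact_mod_cast Nat.one_le_of_lt (r + 1).factorial_pos
      calc h (r + 2) ⬝ᵥ h (r + 2) ≤ C * 1 := by rw [mul_one]; exact le_max_right _ _
        _ ≤ C * (r + 1).factorial := mul_le_mul_of_nonneg_left h1 hCnn
    | succ n hn ihn =>
      have hnr : (r : ℝ) + 1 ≤ n := by exact_mod_cast hn
      have hfs : ((n + 1).factorial : ℝ) = (n + 1) * n.factorial := by
        rw [Nat.factorial_succ]; push_cast; ring
      rw [hstep (n + 1) (by omega), hfs]
      push_cast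
      have h1 := mul_le_mul_of_nonneg_left ihn (show (0 : ℝ) ≤ (n : ℝ) + 1 - r by linarith)
      have hCf : 0 ≤ C * n.factorial := mul_nonneg hCnn (hfac n).le
      -- For `r ≥ 1` the factor `n + 1 - r + 1/2` that comes from the arithmetic-geometric mean
      -- inequality stays below `n + 1` by at least `1/2`; for `r = 0` there is none, but then `g = 0`.
      rcases Nat.eq_zero_or_pos r with rfl | hr
      · rw [hzero g hgup hgorth, dotProduct_zero, add_zero]
        push_cast at h1 ⊢
        nlinarith
      · have hr1 : (1 : ℝ) ≤ r := by exact_mod_cast hr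
        have h2 := hAM (n + 1)
        have h3 := hC' n (by omega)
        have h4 : C' * n.factorial ≤ C * n.factorial :=
          mul_le_mul_of_nonneg_right (le_max_left _ _) (hfac n).le
        have h5 : C * n.factorial ≤ r * (C * n.factorial) := le_mul_of_one_le_left hCf hr1
        nlinarith

end PartitionOf

/-! ### The blocks of the branching rule in the last letter order -/

namespace SYT

open PartitionOf

variable {n : ℕ} {lam : PartitionOf (n + 1)}

/-- The row of the cell that is removed from `lam` to obtain `mu`. -/
noncomputable def removedRow (mu : below lam) : ℕ :=
  (exists_new_cell (mem_below.1 mu.2)).choose.1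

theorem removedRow_injective : Function.Injective (removedRow (lam := lam)) := by
  have key : ∀ mu mu' : below lam, removedRow mu = removedRow mu' →
      (exists_new_cell (mem_below.1 mu'.2)).choose.2 ≤
        (exists_new_cell (mem_below.1 mu.2)).choose.2 := by
    intro mu mu' h
    obtain ⟨hc, hd⟩ := (exists_new_cell (mem_below.1 mu.2)).choose_spec
    obtain ⟨hc', hd'⟩ := (exists_new_cell (mem_below.1 mu'.2)).choose_spec
    unfold removedRow at h
    set c := (exists_new_cell (mem_below.1 mu.2)).choose
    set c' := (exists_new_cell (mem_below.1 mu'.2)).choose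
    by_contra hlt
    rcases (hd c').1 ((hd' c').2 (Or.inl rfl)) with h1 | h1
    · rw [h1] at hlt; exact hlt le_rfl
    · exact hc (mu.1.1.up_left_mem h.le (not_le.1 hlt).le h1)
  intro mu mu' h
  have hcc := Prod.ext h (le_antisymm (key mu' mu h.symm) (key mu mu' h))
  obtain ⟨hc, hd⟩ := (exists_new_cell (mem_below.1 mu.2)).choose_spec
  obtain ⟨hc', hd'⟩ := (exists_new_cell (mem_below.1 mu'.2)).choose_spec
  rw [hcc] at hc hd
  refine Subtype.ext (Subtype.ext (SetLike.ext fun d => ?_))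
  have h1 := (hd d).symm.trans (hd' d)
  constructor
  · intro hdm
    exact (h1.1 (Or.inr hdm)).resolve_left fun h2 => hc (h2 ▸ hdm)
  · intro hdm
    exact (h1.2 (Or.inr hdm)).resolve_left fun h2 => hc' (h2 ▸ hdm)

theorem row_branchEquiv_last (mu : below lam) (T : SYT mu.1) :
    (branchEquiv lam ⟨mu, T⟩).row (Fin.last n) = removedRow mu := by
  obtain ⟨hc, hd⟩ := (exists_new_cell (mem_below.1 mu.2)).choose_spec
  have h1 := (hd _).1 ((branchEquiv lam ⟨mu, T⟩).1.symm (Fin.last n)).2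
  exact congrArg Prod.fst (h1.resolve_right (extend_symm_last_notMem (mem_below.1 mu.2) T))

theorem not_lastLetterLT_self (T : SYT lam) : ¬ T.LastLetterLT T := by
  rintro ⟨k, hk, -⟩
  exact hk.false

theorem lastLetterLT_of_removedRow_lt {mu mu' : below lam} (h : removedRow mu < removedRow mu')
    (T : SYT mu.1) (S : SYT mu'.1) :
    (branchEquiv lam ⟨mu', S⟩).LastLetterLT (branchEquiv lam ⟨mu, T⟩) :=
  ⟨Fin.last n, by rw [row_branchEquiv_last, row_branchEquiv_last]; exact h,
    fun l hl => absurd hl (not_lt.2 (Fin.le_last l))⟩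

theorem removedRow_le_of_lastLetterLT {mu mu' : below lam} (T : SYT mu.1) (S : SYT mu'.1)
    (h : (branchEquiv lam ⟨mu', S⟩).LastLetterLT (branchEquiv lam ⟨mu, T⟩)) :
    removedRow mu ≤ removedRow mu' := by
  obtain ⟨k, hk, hl⟩ := h
  rw [← row_branchEquiv_last mu T, ← row_branchEquiv_last mu' S]
  rcases (Fin.le_last k).eq_or_lt with rfl | hlt
  · exact hk.le
  · exact (hl _ hlt).ge

/-- The number of tableaux in the blocks that precede the block of `mu`. -/
noncomputable def blockStart (mu : below lam) : ℝ :=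
  ∑ mu' : below lam with removedRow mu < removedRow mu', dimFun n mu'.1

theorem card_lastLetterLT (T : SYT lam) :
    ((Finset.univ.filter fun S : SYT lam => S.LastLetterLT T).card : ℝ) =
      ∑ mu' : below lam, ((Finset.univ.filter fun S : SYT mu'.1 =>
        (branchEquiv lam ⟨mu', S⟩).LastLetterLT T).card : ℝ) := by
  simp only [Finset.card_filter]
  rw [← (branchEquiv lam).sum_comp, Fintype.sum_sigma]
  push_cast
  rfl

/-- Together with `index_le_blockStart_add`: the positions of the tableaux in the block of `mu` lie
in a half-open interval of length `dim mu`. -/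
theorem blockStart_lt_index (mu : below lam) (T : SYT mu.1) :
    blockStart mu < (branchEquiv lam ⟨mu, T⟩).index := by
  rw [index, Nat.cast_add_one, card_lastLetterLT, blockStart, Finset.sum_filter]
  refine lt_of_le_of_lt (Finset.sum_le_sum fun mu' _ => ?_) (lt_add_one _)
  split_ifs with h
  · rw [Finset.filter_true_of_mem fun S _ => lastLetterLT_of_removedRow_lt h T S]
    exact le_rfl
  · positivity

theorem index_le_blockStart_add (mu : below lam) (T : SYT mu.1) :
    (branchEquiv lam ⟨mu, T⟩).index ≤ blockStart mu + dimFun n mu.1 := by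
  have h1 : ((Finset.univ.filter fun S : SYT lam =>
      S.LastLetterLT (branchEquiv lam ⟨mu, T⟩)).card : ℝ) ≤
      blockStart mu + (dimFun n mu.1 - 1) := by
    have h2 : dimFun n mu.1 - 1 =
        ∑ mu' : below lam, if mu' = mu then dimFun n mu'.1 - 1 else 0 := by
      simp
    rw [card_lastLetterLT, blockStart, Finset.sum_filter, h2, ← Finset.sum_add_distrib]
    refine Finset.sum_le_sum fun mu' _ => ?_
    rcases lt_trichotomy (removedRow mu) (removedRow mu') with h | h | h
    · rw [if_pos h, if_neg (fun e => by rw [e] at h; exact h.false), add_zero]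
      exact Nat.cast_le.2 (Finset.card_le_univ _)
    · obtain rfl := removedRow_injective h
      rw [if_neg h.not_lt, if_pos rfl, zero_add, le_sub_iff_add_le]
      refine (Nat.cast_add_one _).symm.trans_le (Nat.cast_le.2 ?_)
      exact Finset.card_lt_univ_of_notMem (x := T) (by simp [not_lastLetterLT_self])
    · rw [if_neg h.not_gt, if_neg (fun e => by rw [e] at h; exact h.false), add_zero,
        Finset.filter_false_of_mem fun S _ hS =>
          h.not_ge (removedRow_le_of_lastLetterLT T S hS)]
      simp
  rw [index, Nat.cast_add_one]
  linarith

end SYT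

/-! ### Partial sums in terms of the blocks -/

/-- An interval `[0, x]` cut by consecutive intervals of lengths `w i`: the lengths of the pieces
add up to the total length. -/
theorem sum_clamp_eq {ι : Type*} [DecidableEq ι] (key : ι → ℕ) (hkey : Function.Injective key)
    (s : Finset ι) (w : ι → ℝ) (hw : ∀ i, 0 ≤ w i) (x : ℝ) :
    ∑ i ∈ s, min (max (x - ∑ j ∈ s with key i < key j, w j) 0) (w i) =
      min (max x 0) (∑ i ∈ s, w i) := by
  induction s using Finset.induction_on_min_value key with
  | empty => simp
  | insert a s ha hmin ih =>
    have h1 : ∑ i ∈ s, min (max (x - ∑ j ∈ insert a s with key i < key j, w j) 0) (w i) =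
        min (max x 0) (∑ i ∈ s, w i) := by
      rw [← ih]
      refine Finset.sum_congr rfl fun i hi => ?_
      rw [Finset.filter_insert, if_neg (hmin i hi).not_gt]
    have h2 : (insert a s).filter (fun j => key a < key j) = s := by
      rw [Finset.filter_insert, if_neg (lt_irrefl _), Finset.filter_true_of_mem]
      intro j hj
      exact lt_of_le_of_ne (hmin j hj) fun e => ha (hkey e ▸ hj)
    rw [Finset.sum_insert ha, Finset.sum_insert ha, h2, h1]
    have h3 : 0 ≤ ∑ i ∈ s, w i := Finset.sum_nonneg fun i _ => hw i
    have h4 := hw a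
    rcases le_total x 0 with h5 | h5
    · rw [max_eq_right h5, max_eq_right (by linarith), min_eq_left h4, min_eq_left h3,
        min_eq_left (by linarith), add_zero]
    · rw [max_eq_left h5]
      rcases le_total x (∑ i ∈ s, w i) with h6 | h6
      · rw [max_eq_right (by linarith), min_eq_left h4, min_eq_left h6, min_eq_left (by linarith),
          zero_add]
      · rw [max_eq_left (by linarith), min_eq_right h6, ← min_add_add_right]
        congr 1
        ring

section PartialSum

open PartitionOf SYT

variable {n : ℕ} (ε : ℤˣ) (lam : PartitionOf (n + 1))

/-- The partial sum consists of the sums over the blocks below the cutoff `x = min u₁ u₂ * dim lam`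
and of a part of the at most one block that is cut by `x`. -/
theorem abs_partialSum_sub_le (σ : Equiv.Perm (Fin n)) {u₁ u₂ : ℝ} (hu₁ : u₁ ∈ Set.Icc (0 : ℝ) 1)
    (hu₂ : u₂ ∈ Set.Icc (0 : ℝ) 1) (m : ℝ) :
    |(∑ T : SYT lam with (T.index : ℝ) ≤ u₁ * dimFun (n + 1) lam,
        ∑ S : SYT lam with (S.index : ℝ) ≤ u₂ * dimFun (n + 1) lam,
          youngOrthogonal ε lam (extendPerm n.le_succ σ) T S) -
      min u₁ u₂ * m * dimFun (n + 1) lam| ≤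
    up (fun mu => |entrySum ε σ mu - m * dimFun n mu|) lam +
      (2 ^ (adjWord σ).length + |m|) * √(up (fun mu => dimFun n mu ^ 2) lam) := by
  set F := dimFun (n + 1) lam with hF
  have hF0 : 0 ≤ F := dimFun_nonneg _ _
  set x := min u₁ u₂ * F with hx
  set w : below lam → ℝ := fun mu => dimFun n mu.1 with hw
  have hw0 : ∀ mu, 0 ≤ w mu := fun mu => dimFun_nonneg _ _
  have hFw : F = ∑ mu, w mu := by
    rw [hF, dimFun_succ, up]
    exact (Finset.sum_coe_sort (below lam) (dimFun n)).symm
  have hx0 : 0 ≤ x := mul_nonneg (le_min hu₁.1 hu₂.1) hF0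
  have hxF : x ≤ F := mul_le_of_le_one_left hF0 ((min_le_left _ _).trans hu₁.2)
  -- The length of the part of the block of `mu` that lies below the cutoff `x`.
  set φ : below lam → ℝ := fun mu => min (max (x - blockStart mu) 0) (w mu) with hφ
  have hφsum : ∑ mu, φ mu = x := by
    have := sum_clamp_eq removedRow removedRow_injective Finset.univ w hw0 x
    rw [max_eq_left hx0, ← hFw, min_eq_left hxF] at this
    exact this
  have hx1 : x ≤ u₁ * F := mul_le_mul_of_nonneg_right (min_le_left _ _) hF0
  have hx2 : x ≤ u₂ * F := mul_le_mul_of_nonneg_right (min_le_right _ _) hF0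
  -- The contribution of the block of `mu` to the partial sum.
  set P : below lam → ℝ := fun mu =>
    ∑ T : SYT mu.1 with ((branchEquiv lam ⟨mu, T⟩).index : ℝ) ≤ u₁ * F,
      ∑ S : SYT mu.1 with ((branchEquiv lam ⟨mu, S⟩).index : ℝ) ≤ u₂ * F,
        youngOrthogonal ε mu.1 σ T S with hP
  rw [sum_youngOrthogonal_branch ε lam σ (fun T => (T.index : ℝ) ≤ u₁ * F)
    (fun S => (S.index : ℝ) ≤ u₂ * F)]
  have htarget : min u₁ u₂ * m * F = ∑ mu, m * φ mu := by
    rw [← Finset.mul_sum, hφsum, hx]; ring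
  rw [htarget, ← Finset.sum_sub_distrib]
  set cut : Finset (below lam) :=
    Finset.univ.filter fun mu => blockStart mu < x ∧ x < blockStart mu + w mu with hcut
  set K : ℝ := 2 ^ (adjWord σ).length with hK
  have hblock : ∀ mu : below lam, |P mu - m * φ mu| ≤
      |entrySum ε σ mu.1 - m * w mu| + if mu ∈ cut then (K + |m|) * w mu else 0 := by
    intro mu
    rcases le_or_gt x (blockStart mu) with h1 | h1
    · have hφ0 : φ mu = 0 := by
        simp only [hφ]
        rw [max_eq_right (by linarith), min_eq_left (hw0 mu)]
      have hP0 : P mu = 0 := by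
        simp only [hP]
        rcases le_total u₁ u₂ with h2 | h2
        · rw [Finset.filter_false_of_mem, Finset.sum_empty]
          intro T _ hT
          have := blockStart_lt_index mu T
          rw [hx, min_eq_left h2] at h1
          linarith
        · refine Finset.sum_eq_zero fun T _ => ?_
          rw [Finset.filter_false_of_mem, Finset.sum_empty]
          intro T _ hT
          have := blockStart_lt_index mu T
          rw [hx, min_eq_right h2] at h1
          linarith
      rw [hφ0, hP0, if_neg (by simp [hcut, h1])]
      simp
    · rcases le_or_gt (blockStart mu + w mu) x with h2 | h2
      · have hφ1 : φ mu = w mu := by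
          simp only [hφ]
          rw [max_eq_left (by linarith), min_eq_right (by linarith)]
        have hP1 : P mu = entrySum ε σ mu.1 := by
          simp only [hP, entrySum]
          have h3 : ∀ T : SYT mu.1, ((branchEquiv lam ⟨mu, T⟩).index : ℝ) ≤ x := fun T =>
            (index_le_blockStart_add mu T).trans h2
          rw [Finset.filter_true_of_mem fun T _ => (h3 T).trans hx1,
            Finset.filter_true_of_mem fun T _ => (h3 T).trans hx2]
        rw [hφ1, hP1, if_neg (by simp [hcut, h2]), add_zero]
      · rw [if_pos (by simp [hcut, h1, h2])]
        have h3 : |P mu| ≤ K * w mu := abs_sum_youngOrthogonal_le ε mu.1 σ _ _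
        have h4 : |m * φ mu| ≤ |m| * w mu := by
          rw [abs_mul]
          refine mul_le_mul_of_nonneg_left ?_ (abs_nonneg m)
          rw [abs_of_nonneg (le_min (le_max_right _ _) (hw0 mu))]
          exact min_le_right _ _
        have h5 := abs_sub (P mu) (m * φ mu)
        have h6 := abs_nonneg (entrySum ε σ mu.1 - m * w mu)
        linarith
  have hcutsum : ∑ mu ∈ cut, w mu ≤ √(∑ mu, w mu ^ 2) := by
    rcases cut.eq_empty_or_nonempty with h | ⟨mu, hmu⟩
    · rw [h, Finset.sum_empty]
      exact Real.sqrt_nonneg _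
    · have hdisj : ∀ a b : below lam, a ∈ cut → b ∈ cut → ¬ removedRow a < removedRow b := by
        intro a b ha hb hab
        simp only [hcut, Finset.mem_filter, Finset.mem_univ, true_and] at ha hb
        have h1 : blockStart b + w b ≤ blockStart a := by
          unfold blockStart
          rw [add_comm, ← Finset.sum_insert (by simp)]
          refine Finset.sum_le_sum_of_subset_of_nonneg ?_ fun i _ _ => hw0 i
          intro c hc
          rw [Finset.mem_insert, Finset.mem_filter] at hc
          rw [Finset.mem_filter]
          refine ⟨Finset.mem_univ _, ?_⟩
          rcases hc with rfl | hc
          · exact hab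
          · exact hab.trans hc.2
        linarith
      have hsing : cut = {mu} := by
        refine Finset.eq_singleton_iff_unique_mem.2 ⟨hmu, fun nu hnu => removedRow_injective ?_⟩
        exact le_antisymm (not_lt.1 (hdisj mu nu hmu hnu)) (not_lt.1 (hdisj nu mu hnu hmu))
      rw [hsing, Finset.sum_singleton]
      apply Real.le_sqrt_of_sq_le
      exact Finset.single_le_sum (f := fun mu => w mu ^ 2) (fun i _ => sq_nonneg _)
        (Finset.mem_univ mu)
  have hK0 : 0 ≤ K + |m| := by positivity
  have e1 : up (fun mu => |entrySum ε σ mu - m * dimFun n mu|) lam =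
      ∑ mu : below lam, |entrySum ε σ mu.1 - m * w mu| :=
    (Finset.sum_coe_sort (below lam) fun mu => |entrySum ε σ mu - m * dimFun n mu|).symm
  have e2 : up (fun mu => dimFun n mu ^ 2) lam = ∑ mu, w mu ^ 2 :=
    (Finset.sum_coe_sort (below lam) fun mu => dimFun n mu ^ 2).symm
  rw [e1, e2]
  calc |∑ mu, (P mu - m * φ mu)| ≤ ∑ mu, |P mu - m * φ mu| := Finset.abs_sum_le_sum_abs _ _
    _ ≤ ∑ mu, (|entrySum ε σ mu.1 - m * w mu| + if mu ∈ cut then (K + |m|) * w mu else 0) :=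
        Finset.sum_le_sum fun mu _ => hblock mu
    _ = ∑ mu : below lam, |entrySum ε σ mu.1 - m * w mu| + (K + |m|) * ∑ mu ∈ cut, w mu := by
        rw [Finset.sum_add_distrib, Finset.sum_ite_mem, Finset.univ_inter, Finset.mul_sum]
    _ ≤ _ := by gcongr

end PartialSum

/-! ### Plancherel averages -/

section Plancherel

open PartitionOf

theorem plancherelExp_eq_dotProduct (n : ℕ) (f : PartitionOf n → ℝ) :
    plancherelExp n f = dimFun n ⬝ᵥ (fun lam => dimFun n lam * f lam) / n.factorial := by
  rw [plancherelExp, dotProduct, Finset.sum_div]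
  refine Finset.sum_congr rfl fun lam _ => ?_
  rw [dimFun]
  ring

/-- Markov's inequality for the Plancherel measure. -/
theorem plancherelProb_le (n : ℕ) (X : PartitionOf n → ℝ) (c : ℝ) {δ : ℝ} (hδ : 0 < δ) :
    plancherelProb n {lam | δ < |X lam - c|} ≤ plancherelExp n (fun lam => |X lam - c|) / δ := by
  rw [le_div_iff₀ hδ, plancherelProb, plancherelExp, plancherelExp, Finset.sum_mul]
  refine Finset.sum_le_sum fun lam _ => ?_
  rw [mul_assoc]
  refine mul_le_mul_of_nonneg_left ?_ (by positivity)
  by_cases h : lam ∈ {lam | δ < |X lam - c|}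
  · rw [Set.indicator_of_mem h, Pi.one_apply, one_mul]
    exact le_of_lt h
  · rw [Set.indicator_of_notMem h, zero_mul]
    exact abs_nonneg _

theorem plancherelProb_nonneg (n : ℕ) (A : Set (PartitionOf n)) : 0 ≤ plancherelProb n A :=
  Finset.sum_nonneg fun lam _ => mul_nonneg (by positivity)
    (Set.indicator_nonneg (fun _ _ => zero_le_one) lam)

theorem factorial_pos_real (n : ℕ) : (0 : ℝ) < n.factorial := Nat.cast_pos.2 n.factorial_pos

theorem dotProduct_le_sqrt {n : ℕ} (f g : PartitionOf n → ℝ) :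
    f ⬝ᵥ g ≤ √(f ⬝ᵥ f) * √(g ⬝ᵥ g) := by
  have := Real.sum_mul_le_sqrt_mul_sqrt Finset.univ f g
  simpa only [dotProduct, sq] using this

/-- The sum over `lam ⊢ n + 1` of the squared dimensions of the lower covers of `lam`; it is small
compared with `(n + 1)!` since a partition of `n` has only `O(√n)` corners. -/
theorem sum_up_dimFun_sq_le (n : ℕ) :
    ∑ lam, up (fun mu => dimFun n mu ^ 2) lam ≤ (√(2 * n) + 1) * n.factorial := by
  have h1 : ∑ lam, up (fun mu => dimFun n mu ^ 2) lam =
      (fun mu => dimFun n mu ^ 2) ⬝ᵥ down (1 : PartitionOf (n + 1) → ℝ) := by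
    rw [← up_dotProduct, dotProduct_one]
  rw [h1, ← dimFun_dotProduct_self, dotProduct, dotProduct, Finset.mul_sum]
  refine Finset.sum_le_sum fun mu _ => ?_
  have h2 : down (1 : PartitionOf (n + 1) → ℝ) mu ≤ √(2 * n) + 1 := by
    rw [down]
    simp only [Pi.one_apply, Finset.sum_const, nsmul_eq_mul, mul_one, card_above]
    push_cast
    refine add_le_add_left (Real.le_sqrt_of_sq_le ?_) 1
    exact_mod_cast card_removableRows_sq_le mu
  rw [mul_comm, ← sq]
  exact mul_le_mul_of_nonneg_right h2 (sq_nonneg _)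

/-- The expected error of the partial sums for `n + 1` is bounded by the second moment of the error
of the total sum for `n` and by the average size of the block that is cut. -/
theorem plancherelExp_abs_partialSum₂_sub_le (ε : ℤˣ) {n : ℕ} (σ : Equiv.Perm (Fin n)) {u₁ u₂ : ℝ}
    (hu₁ : u₁ ∈ Set.Icc (0 : ℝ) 1) (hu₂ : u₂ ∈ Set.Icc (0 : ℝ) 1) (m : ℝ) :
    plancherelExp (n + 1)
      (fun lam => |partialSum₂ ε lam u₁ u₂ (extendPerm n.le_succ σ) - min u₁ u₂ * m|) ≤
    √((entrySum ε σ - m • dimFun n) ⬝ᵥ (entrySum ε σ - m • dimFun n) / n.factorial) +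
      (2 ^ (adjWord σ).length + |m|) * √((√(2 * n) + 1) / (n + 1)) := by
  set h : PartitionOf n → ℝ := entrySum ε σ - m • dimFun n with hh
  set K : ℝ := 2 ^ (adjWord σ).length + |m| with hK
  have hK0 : 0 ≤ K := by positivity
  set q : PartitionOf (n + 1) → ℝ := up (fun mu => dimFun n mu ^ 2) with hq
  have hq0 : ∀ lam, 0 ≤ q lam := fun lam => Finset.sum_nonneg fun _ _ => sq_nonneg _
  have hn1 : (0 : ℝ) < n + 1 := by positivity
  have hf := factorial_pos_real n
  have hfs : ((n + 1).factorial : ℝ) = (n + 1) * n.factorial := by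
    rw [Nat.factorial_succ]; push_cast; ring
  have hpt : ∀ lam : PartitionOf (n + 1), dimFun (n + 1) lam *
      |partialSum₂ ε lam u₁ u₂ (extendPerm n.le_succ σ) - min u₁ u₂ * m| ≤
      up (fun mu => |h mu|) lam + K * √(q lam) := by
    intro lam
    refine le_trans (le_of_eq ?_) (abs_partialSum_sub_le ε lam σ hu₁ hu₂ m)
    rw [← abs_of_nonneg (dimFun_nonneg (n + 1) lam), ← abs_mul, abs_of_nonneg (dimFun_nonneg _ _)]
    congr 1
    rw [mul_sub, partialSum₂]
    simp only [← Finset.sum_div]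
    congr 1
    · rcases Nat.eq_zero_or_pos (dimSYT lam) with h0 | h0
      · have : IsEmpty (SYT lam) := Fintype.card_eq_zero_iff.1 h0
        simp
      · exact mul_div_cancel₀ _ (Nat.cast_ne_zero.2 h0.ne')
    · ring
  have hA : dimFun (n + 1) ⬝ᵥ up (fun mu => |h mu|) ≤
      (n + 1) * (√n.factorial * √(h ⬝ᵥ h)) := by
    rw [dimFun_dotProduct_up]
    refine mul_le_mul_of_nonneg_left ((dotProduct_le_sqrt _ _).trans_eq ?_) hn1.le
    rw [dimFun_dotProduct_self]
    congr 2
    simp only [dotProduct, abs_mul_abs_self]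
  have hB : dimFun (n + 1) ⬝ᵥ (fun lam => √(q lam)) ≤
      √(n + 1).factorial * √((√(2 * n) + 1) * n.factorial) := by
    refine (dotProduct_le_sqrt _ _).trans ?_
    rw [dimFun_dotProduct_self]
    refine mul_le_mul_of_nonneg_left (Real.sqrt_le_sqrt ?_) (Real.sqrt_nonneg _)
    simp only [dotProduct, Real.mul_self_sqrt (hq0 _)]
    exact sum_up_dimFun_sq_le n
  have hsum : dimFun (n + 1) ⬝ᵥ (fun lam => dimFun (n + 1) lam *
      |partialSum₂ ε lam u₁ u₂ (extendPerm n.le_succ σ) - min u₁ u₂ * m|) ≤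
      (n + 1) * (√n.factorial * √(h ⬝ᵥ h)) +
        K * (√(n + 1).factorial * √((√(2 * n) + 1) * n.factorial)) := by
    calc _ ≤ dimFun (n + 1) ⬝ᵥ (up (fun mu => |h mu|) + K • fun lam => √(q lam)) :=
          Finset.sum_le_sum fun lam _ => mul_le_mul_of_nonneg_left (hpt lam) (dimFun_nonneg _ _)
      _ ≤ _ := by
          rw [dotProduct_add, dotProduct_smul, smul_eq_mul]
          exact add_le_add hA (mul_le_mul_of_nonneg_left hB hK0)
  rw [plancherelExp_eq_dotProduct, div_le_iff₀ (factorial_pos_real _)]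
  refine hsum.trans_eq ?_
  have hs1 : √(n.factorial : ℝ) * √(n.factorial : ℝ) = n.factorial := Real.mul_self_sqrt hf.le
  have hs2 : √((n + 1).factorial : ℝ) * √((n + 1).factorial : ℝ) = (n + 1).factorial :=
    Real.mul_self_sqrt (factorial_pos_real _).le
  have e1 : √(h ⬝ᵥ h) = √(h ⬝ᵥ h / n.factorial) * √n.factorial := by
    rw [← Real.sqrt_mul' _ hf.le, div_mul_cancel₀ _ hf.ne']
  have e2 : √((√(2 * n) + 1) * n.factorial) =
      √((√(2 * n) + 1) / (n + 1)) * √(n + 1).factorial := by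
    rw [← Real.sqrt_mul' _ (factorial_pos_real _).le, hfs]
    congr 1
    field_simp
  rw [e1, e2]
  linear_combination (n + 1 : ℝ) * √(h ⬝ᵥ h / n.factorial) * hs1 +
    K * √((√(2 * n) + 1) / (n + 1)) * hs2 - √(h ⬝ᵥ h / n.factorial) * hfs

theorem dimFun_dotProduct_entrySum (ε : ℤˣ) {r : ℕ} (σ : Equiv.Perm (Fin r)) :
    dimFun r ⬝ᵥ entrySum ε σ = meanTotalSum ε σ * r.factorial := by
  rw [meanTotalSum, plancherelExp_eq_dotProduct, div_mul_cancel₀ _ (factorial_pos_real r).ne']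
  simp only [dimFun_mul_totalSum]

/-- The second moment of `TS^lam(σ) - m_σ` is `O(1 / n)`. -/
theorem exists_entrySum_bound (ε : ℤˣ) {r : ℕ} (σ : Equiv.Perm (Fin r)) :
    ∃ C : ℝ, ∀ (n : ℕ) (hn : r ≤ n),
      (entrySum ε (extendPerm (hn.trans n.le_succ) σ) - meanTotalSum ε σ • dimFun (n + 1)) ⬝ᵥ
        (entrySum ε (extendPerm (hn.trans n.le_succ) σ) - meanTotalSum ε σ • dimFun (n + 1)) ≤
      C * n.factorial := by
  set h : ∀ n, PartitionOf n → ℝ := fun n =>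
    if hn : r ≤ n then entrySum ε (extendPerm hn σ) - meanTotalSum ε σ • dimFun n else 0 with hh
  have h1 : ∀ (n : ℕ) (hn : r ≤ n),
      h n = entrySum ε (extendPerm hn σ) - meanTotalSum ε σ • dimFun n := fun n hn => dif_pos hn
  have hup : ∀ n, r ≤ n → h (n + 1) = up (h n) := by
    intro n hn
    rw [h1 n hn, h1 (n + 1) (hn.trans n.le_succ), extendPerm_succ hn, entrySum_succ, up_sub,
      up_smul, dimFun_succ]
  have horth : dimFun r ⬝ᵥ h r = 0 := by
    rw [h1 r le_rfl, extendPerm_self, dotProduct_sub, dotProduct_smul, dimFun_dotProduct_entrySum,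
      dimFun_dotProduct_self, smul_eq_mul, sub_self]
  obtain ⟨C, hC⟩ := exists_orbit_bound r h hup horth
  refine ⟨C, fun n hn => ?_⟩
  have := hC n hn
  rwa [h1 (n + 1) (hn.trans n.le_succ)] at this

theorem sqrt_two_mul_add_one_div_le (n : ℕ) :
    (√(2 * n) + 1) / ((n : ℝ) + 1) ≤ 3 / √((n : ℝ) + 1) := by
  have hn : (0 : ℝ) ≤ n := Nat.cast_nonneg n
  have hs : (0 : ℝ) < √((n : ℝ) + 1) := Real.sqrt_pos.2 (by positivity)
  have hss : √((n : ℝ) + 1) * √((n : ℝ) + 1) = n + 1 := Real.mul_self_sqrt (by positivity)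
  have h1 : √(2 * n) ≤ 2 * √((n : ℝ) + 1) := by
    apply Real.sqrt_le_iff.2
    exact ⟨by positivity, by nlinarith⟩
  have h2 : 1 ≤ √((n : ℝ) + 1) := Real.one_le_sqrt.2 (by linarith)
  rw [div_le_div_iff₀ (by positivity) hs]
  nlinarith

theorem tendstoInPlancherelProb_partialSum₂ (ε : ℤˣ) {r : ℕ} (σ : Equiv.Perm (Fin r)) {u₁ u₂ : ℝ}
    (hu₁ : u₁ ∈ Set.Icc (0 : ℝ) 1) (hu₂ : u₂ ∈ Set.Icc (0 : ℝ) 1) :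
    TendstoInPlancherelProb r (fun _ h lam => partialSum₂ ε lam u₁ u₂ (extendPerm h σ))
      (min u₁ u₂ * meanTotalSum ε σ) := by
  intro δ hδ
  obtain ⟨C, hC⟩ := exists_entrySum_bound ε σ
  set m := meanTotalSum ε σ with hm
  set K : ℝ := 2 ^ (adjWord σ).length + |m| with hK
  have hK0 : 0 ≤ K := by positivity
  -- Used for `n ≥ r + 2`: the total sum for `n - 1` has second moment at most `C / (n - 1)`.
  set b : ℕ → ℝ := fun n => (√(C / ((n - 1 : ℕ) : ℝ)) + K * √(3 / √(n : ℝ))) / δ with hb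
  have hcast : Tendsto (fun n : ℕ => (n : ℝ)) atTop atTop := tendsto_natCast_atTop_atTop
  have hsqrt0 : Tendsto Real.sqrt (𝓝 0) (𝓝 0) := Real.continuous_sqrt.tendsto' 0 0 Real.sqrt_zero
  have hb0 : Tendsto b atTop (𝓝 0) := by
    have t1 : Tendsto (fun n : ℕ => √(C / ((n - 1 : ℕ) : ℝ))) atTop (𝓝 0) :=
      hsqrt0.comp ((hcast.comp (tendsto_sub_atTop_nat 1)).const_div_atTop C)
    have t2 : Tendsto (fun n : ℕ => √(3 / √(n : ℝ))) atTop (𝓝 0) :=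
      hsqrt0.comp ((Real.tendsto_sqrt_atTop.comp hcast).const_div_atTop 3)
    have := (t1.add (t2.const_mul K)).div_const δ
    simpa only [mul_zero, add_zero, zero_div] using this
  have hbound : ∀ (n : ℕ) (hn : r ≤ n), r + 2 ≤ n →
      plancherelProb n {lam | δ < |partialSum₂ ε lam u₁ u₂ (extendPerm hn σ) - min u₁ u₂ * m|} ≤
        b n := by
    intro n hn hn2
    obtain ⟨M, rfl⟩ : ∃ M, n = M + 1 + 1 := ⟨n - 2, by omega⟩
    have hM : r ≤ M := by omega
    have hM1 : r ≤ M + 1 := hM.trans M.le_succ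
    refine (plancherelProb_le _ _ _ hδ).trans (div_le_div_of_nonneg_right ?_ hδ.le)
    rw [extendPerm_succ hM1]
    refine (plancherelExp_abs_partialSum₂_sub_le ε (extendPerm hM1 σ) hu₁ hu₂ m).trans ?_
    rw [length_adjWord_extendPerm]
    refine add_le_add (Real.sqrt_le_sqrt ?_) (mul_le_mul_of_nonneg_left (Real.sqrt_le_sqrt ?_) hK0)
    · have hf := factorial_pos_real M
      have hM0 : (0 : ℝ) < (M : ℝ) + 1 := by positivity
      rw [Nat.factorial_succ, Nat.add_sub_cancel]
      push_cast
      rw [div_le_div_iff₀ (by positivity) hM0]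
      have := mul_le_mul_of_nonneg_right (hC M hM) hM0.le
      linarith
    · rw [Nat.cast_add_one (M + 1)]
      exact sqrt_two_mul_add_one_div_le (M + 1)
  refine squeeze_zero' (Eventually.of_forall fun n => plancherelProb_nonneg _ _) ?_
    (hb0.comp (tendsto_comp_val_Ici_atTop.2 tendsto_id))
  filter_upwards [eventually_ge_atTop (⟨r + 2, by simp⟩ : Set.Ici r)] with n hn
  exact hbound n.1 n.2 hn

end Plancherel

theorem mainTheorem4 (ε : ℤˣ) (r : ℕ) (σ : Equiv.Perm (Fin r)) :
    (∀ u : ℝ, u ∈ Set.Icc (0 : ℝ) 1 →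
      TendstoInPlancherelProb r
        (fun _ h lam => partialSum ε lam u (extendPerm h σ))
        (u * meanTotalSum ε σ)) ∧
    (∀ u₁ u₂ : ℝ, u₁ ∈ Set.Icc (0 : ℝ) 1 → u₂ ∈ Set.Icc (0 : ℝ) 1 →
      TendstoInPlancherelProb r
        (fun _ h lam => partialSum₂ ε lam u₁ u₂ (extendPerm h σ))
        (min u₁ u₂ * meanTotalSum ε σ)) := by
  -- The first part is the case `u₁ = u₂ = u` of the second.
  refine ⟨fun u hu => ?_, fun u₁ u₂ hu₁ hu₂ => tendstoInPlancherelProb_partialSum₂ ε σ hu₁ hu₂⟩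
  have := tendstoInPlancherelProb_partialSum₂ ε σ hu hu
  rwa [min_self] at this
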